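/- Let $J_\nu(z)=(z/2)^\nu\sum_{k\ge 0}\frac{(-1)^k(z^2/4)^k}{k!\,\Gamma(\nu+k+1)}$ be the Bessel function of the first kind, $Y_\nu(z)=\frac{J_\nu(z)\cos(\nu\pi)-J_{-\nu}(z)}{\sin(\nu\pi)}$ that of the second kind (at integer $\nu$ the limiting value), and $H^{(1)}_\nu(z)=J_\nu(z)+iY_\nu(z)$ the Hankel function of the first kind, all on their principal branches. Let $$\mathbf{A}_\nu(z)=\frac1\pi\int_0^{+\infty}e^{-\nu t-z\sinh t}\,dt\qquad\left(|\arg z|<\tfrac{\pi}{2}\right)$$ be the Anger–Weber function. Let $\lambda>0$ be a fixed real number and let $N\ge 0$ be an integer. Then for every complex $\nu\neq 0$ with $|\arg\nu|<\frac{\pi}{2}$, $$\mathbf{A}_\nu(\lambda\nu)=\frac1\pi\sum_{n=0}^{N-1}\frac{(2n)!\,a_n(\lambda)}{\nu^{2n+1}}+R_N(\nu,\lambda)$$ (empty sums are zero), where for every integer $n\ge 0$ $$a_n(\lambda)=\frac{1}{(2n)!}\left[\frac{d^{2n}}{dt^{2n}}\left(\frac{t}{\lambda\sinh t+t}\right)^{2n+1}\right]_{t=0}=\frac{(-1)^n}{(2n)!}\int_0^{+\infty}t^{2n}e^{-\pi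 t}\,iH^{(1)}_{it}(\lambda it)\,dt$$ (the singularity of $t/(\lambda\sinh t+t)$ at $t=0$ being removed by the value $1/(1+\lambda)$), and $$R_N(\nu,\lambda)=\frac{(-1)^N}{\pi\nu^{2N+1}}\int_0^{+\infty}\frac{t^{2N}e^{-\pi t}}{1+(t/\nu)^2}\,iH^{(1)}_{it}(\lambda it)\,dt.$$ All derivatives involved exist and all integrals over $(0,+\infty)$ involved converge absolutely. -/

import Mathlib

open Complex MeasureTheory Filter Topology Set

noncomputable section

/-- The Bessel function of the first kind `J_ν(z)`, complex order `ν` and argument `z`,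
principal branch: `(z/2)^ν ∑ₖ (-1)^k (z²/4)^k / (k! Γ(ν+k+1))`.
(In Mathlib `Γ` takes the value `0` at its poles, so `(Gamma s)⁻¹` is the entire function `1/Γ`.) -/
def besselJ (ν z : ℂ) : ℂ :=
  (z / 2) ^ ν *
    ∑' k : ℕ, (-1 : ℂ) ^ k * (z ^ 2 / 4) ^ k / (k.factorial : ℂ) * (Complex.Gamma (ν + k + 1))⁻¹

/-- The quotient `(J_ν(z) cos(νπ) - J_{-ν}(z)) / sin(νπ)`, meaningful for non-integer `ν`. -/
def besselYQuotient (ν z : ℂ) : ℂ :=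
  (besselJ ν z * Complex.cos (ν * Real.pi) - besselJ (-ν) z) / Complex.sin (ν * Real.pi)

open Classical in
/-- The Bessel function of the second kind `Y_ν(z)`, principal branch; at integer orders it is the
limiting value of the quotient. -/
def besselY (ν z : ℂ) : ℂ :=
  if ∃ m : ℤ, ν = m then limUnder (𝓝[≠] ν) (fun μ => besselYQuotient μ z)
  else besselYQuotient ν z

/-- The Hankel function of the first kind `H_ν^{(1)}(z) = J_ν(z) + i Y_ν(z)`, principal branch. -/
def hankelH1 (ν z : ℂ) : ℂ := besselJ ν z + Complex.I * besselY ν z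

/-- The Anger–Weber function `𝐀_ν(z) = (1/π) ∫₀^∞ e^{-νt - z sinh t} dt`, for complex `ν` and
`|arg z| < π/2`. -/
def angerWeberA (ν z : ℂ) : ℂ :=
  1 / (Real.pi : ℂ) *
    ∫ t in Ioi (0 : ℝ), Complex.exp (-ν * (t : ℂ) - z * ((Real.sinh t : ℝ) : ℂ))

/-- The function `t ↦ t / (λ sinh t + t)` with its removable singularity at `t = 0` filled in
(by `1/(λ+1)`, the limit, see `tendsto_sinhQuotient`). -/
def sinhQuotient (lam t : ℝ) : ℝ :=
  if t = 0 then 1 / (lam + 1) else t / (lam * Real.sinh t + t)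

theorem tendsto_sinhQuotient {lam : ℝ} (hlam : 0 < lam) :
    Tendsto (fun t : ℝ => t / (lam * Real.sinh t + t)) (𝓝[≠] 0) (𝓝 (sinhQuotient lam 0)) := by
  have h : HasDerivAt (fun t : ℝ => lam * Real.sinh t + t) (lam * Real.cosh 0 + 1) 0 :=
    ((Real.hasDerivAt_sinh 0).const_mul lam).add (hasDerivAt_id 0)
  have h2 := (hasDerivAt_iff_tendsto_slope.mp h).inv₀ (by simp; positivity)
  simp only [Real.cosh_zero, mul_one] at h2
  simp only [sinhQuotient, if_true, one_div]
  refine h2.congr fun t => ?_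
  simp [slope_def_field]

/-- The coefficient
`a_n(λ) = (1/(2n)!) [ d^{2n}/dt^{2n} (t / (λ sinh t + t))^{2n+1} ]_{t=0}`. -/
def awCoeff (n : ℕ) (lam : ℝ) : ℝ :=
  1 / ((2 * n).factorial : ℝ) *
    iteratedDeriv (2 * n) (fun t : ℝ => sinhQuotient lam t ^ (2 * n + 1)) 0

/-- The function `t ↦ t^{2n} e^{-πt} i H_{it}^{(1)}(λ i t)`. -/
def coeffIntegrand (n : ℕ) (lam t : ℝ) : ℂ :=
  (t : ℂ) ^ (2 * n) * Complex.exp (-(Real.pi : ℂ) * t) *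
    (Complex.I * hankelH1 (Complex.I * t) (lam * Complex.I * t))

/-- The function `t ↦ t^{2N} e^{-πt} / (1 + (t/ν)²) · i H_{it}^{(1)}(λ i t)`. -/
def remainderIntegrand (N : ℕ) (ν : ℂ) (lam t : ℝ) : ℂ :=
  (t : ℂ) ^ (2 * N) * Complex.exp (-(Real.pi : ℂ) * t) / (1 + ((t : ℂ) / ν) ^ 2) *
    (Complex.I * hankelH1 (Complex.I * t) (lam * Complex.I * t))

/-- The remainder
`R_N(ν, λ) = ((-1)^N / (π ν^{2N+1})) ∫₀^∞ t^{2N} e^{-πt} / (1 + (t/ν)²) · i H_{it}^{(1)}(λ i t) dt`. -/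
def remainder (N : ℕ) (ν : ℂ) (lam : ℝ) : ℂ :=
  (-1 : ℂ) ^ N / ((Real.pi : ℂ) * ν ^ (2 * N + 1)) *
    ∫ t in Ioi (0 : ℝ), remainderIntegrand N ν lam t

end

/-! Write `φ(w) = w + λ sinh w` and `W(x) = e^{-πx} i H_{ix}^{(1)}(iλx)`. Up to elementary factors
`W(x)` is the Macdonald function `K_{ix}(λx)`, so that `π W(x) = ∫_ℝ e^{-x(π/2 + λ cosh u - iu)} du`
(`hankelH1_imaginary`), where the bracket is `-i φ(u + iπ/2)`. Integrating in `x` first turns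
moments and cosine transforms of `W` into integrals of powers of `1/(φ - s)`, `s` real, along `Im w
= ±π/2`. In the strip `|Im w| < π` the function `φ` takes a real value only at one real point, and
simply, so the residue theorem evaluates these integrals (`integral_inv_shiftedPhase`).

The pole at `0` gives the moments `∫ x^{2n} W = (-1)^n (2n)! a_n`. The simple pole at `t` gives `∫
cos(x φ(t)) W(x) dx = 1/φ'(t)`. Expanding `1/(1 + (x/ν)²)` as `ν ∫ cos(xs) e^{-νs} ds` and
substituting `s = φ(t)` then cancels the Jacobian and leaves `∫ e^{-νφ(t)} dt = π 𝐀_ν(λν)`, which is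
the case `N = 0`. One step of the geometric series for `1/(1 + (x/ν)²)` passes from `N` to `N + 1`.

The representation of `W` is proved without Bessel's equation. The integral and the connection
formula satisfy the same differential-difference relations and have the same limits at `0+` for
orders `1 ± ν`; Grönwall's inequality makes them equal. -/

/-! ### Residue calculus on a rectangle. -/

/-- The counterclockwise integral of `f` over the boundary of `[-T, T] × [-h, h]`. -/
noncomputable def rectIntegral (h T : ℝ) (f : ℂ → ℂ) : ℂ :=
  (∫ x in -T..T, f (x + ((-h : ℝ) : ℂ) * I)) - (∫ x in -T..T, f (x + (h : ℂ) * I)) +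
    I * (∫ y in -h..h, f (T + y * I)) - I * (∫ y in -h..h, f (((-T : ℝ) : ℂ) + y * I))

theorem rectIntegral_eq_zero {h T : ℝ} {f : ℂ → ℂ}
    (hf : DifferentiableOn ℂ f ((uIcc (-T) T) ×ℂ (uIcc (-h) h))) : rectIntegral h T f = 0 := by
  have := integral_boundary_rect_eq_zero_of_differentiableOn f ⟨-T, -h⟩ ⟨T, h⟩ hf
  simpa only [rectIntegral, smul_eq_mul] using this

/-- Continuity on the four edges of the rectangle. -/
structure RectContinuous (h T : ℝ) (f : ℂ → ℂ) : Prop where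
  bottom : Continuous fun x : ℝ => f (x + ((-h : ℝ) : ℂ) * I)
  top : Continuous fun x : ℝ => f (x + (h : ℂ) * I)
  right : ContinuousOn (fun y : ℝ => f (T + y * I)) (uIcc (-h) h)
  left : ContinuousOn (fun y : ℝ => f (((-T : ℝ) : ℂ) + y * I)) (uIcc (-h) h)

theorem rectIntegral_add {h T : ℝ} {f g : ℂ → ℂ} (hf : RectContinuous h T f)
    (hg : RectContinuous h T g) :
    rectIntegral h T (fun w => f w + g w) = rectIntegral h T f + rectIntegral h T g := by
  simp only [rectIntegral]
  rw [intervalIntegral.integral_add (hf.bottom.intervalIntegrable _ _)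
      (hg.bottom.intervalIntegrable _ _),
    intervalIntegral.integral_add (hf.top.intervalIntegrable _ _)
      (hg.top.intervalIntegrable _ _),
    intervalIntegral.integral_add hf.right.intervalIntegrable hg.right.intervalIntegrable,
    intervalIntegral.integral_add hf.left.intervalIntegrable hg.left.intervalIntegrable]
  ring

theorem rectIntegral_const_mul {h T : ℝ} (c : ℂ) (f : ℂ → ℂ) :
    rectIntegral h T (fun w => c * f w) = c * rectIntegral h T f := by
  simp only [rectIntegral, intervalIntegral.integral_const_mul]
  ring

/-- A function continuous on the strip `|Im w| ≤ h` away from an interior point of the rectangle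
is continuous on its edges. -/
theorem RectContinuous.of_continuousOn {h T p : ℝ} (hh : 0 < h) (hp : |p| < T) {f : ℂ → ℂ}
    (hf : ContinuousOn f {w | |w.im| ≤ h ∧ w ≠ p}) : RectContinuous h T f := by
  have hT := abs_lt.mp hp
  refine ⟨?_, ?_, ?_, ?_⟩
  · rw [← continuousOn_univ]
    refine hf.comp (by fun_prop) fun x _ => ⟨by simp [abs_of_pos hh], fun e => ?_⟩
    have := congrArg im e
    simp at this; linarith
  · rw [← continuousOn_univ]
    refine hf.comp (by fun_prop) fun x _ => ⟨by simp [abs_of_pos hh], fun e => ?_⟩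
    have := congrArg im e
    simp at this; linarith
  · refine hf.comp (by fun_prop) fun x hx => ⟨?_, fun e => ?_⟩
    · rw [uIcc_of_le (by linarith)] at hx
      simpa using abs_le.mpr hx
    · have := congrArg re e
      simp at this; linarith
  · refine hf.comp (by fun_prop) fun x hx => ⟨?_, fun e => ?_⟩
    · rw [uIcc_of_le (by linarith)] at hx
      simpa using abs_le.mpr hx
    · have := congrArg re e
      simp at this; linarith

theorem integral_horizontal_eq_sub {a b h : ℝ} {f g : ℂ → ℂ}
    (hg : ∀ x : ℝ, HasDerivAt g (f (x + (h : ℂ) * I)) (x + (h : ℂ) * I))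
    (hf : Continuous fun x : ℝ => f (x + (h : ℂ) * I)) :
    ∫ x in a..b, f (x + (h : ℂ) * I) = g (b + h * I) - g (a + h * I) := by
  refine intervalIntegral.integral_eq_sub_of_hasDerivAt (f := fun x : ℝ => g (x + h * I))
    (fun x _ => ?_) (hf.intervalIntegrable _ _)
  have h1 : HasDerivAt (fun z : ℂ => z + h * I) 1 (x : ℂ) := (hasDerivAt_id _).add_const _
  simpa using ((hg x).comp (x : ℂ) h1).comp_ofReal

theorem integral_vertical_eq_sub {a b T : ℝ} {f g : ℂ → ℂ}
    (hg : ∀ y ∈ uIcc a b, HasDerivAt g (f (T + (y : ℂ) * I)) (T + (y : ℂ) * I))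
    (hf : ContinuousOn (fun y : ℝ => f (T + (y : ℂ) * I)) (uIcc a b)) :
    I * ∫ y in a..b, f (T + (y : ℂ) * I) = g (T + b * I) - g (T + a * I) := by
  rw [← intervalIntegral.integral_const_mul]
  refine intervalIntegral.integral_eq_sub_of_hasDerivAt (f := fun y : ℝ => g (T + y * I))
    (fun y hy => ?_) (hf.intervalIntegrable.const_mul _)
  have h1 : HasDerivAt (fun z : ℂ => T + z * I) I (y : ℂ) := by
    simpa using ((hasDerivAt_id (y : ℂ)).mul_const I).const_add (T : ℂ)
  simpa [mul_comm] using ((hg y hy).comp (y : ℂ) h1).comp_ofReal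

/-- The left edge has its own primitive `l`, so that the branch cut of a logarithm may cross that
edge. -/
theorem rectIntegral_eq_of_hasDerivAt {h T : ℝ} {f g l : ℂ → ℂ} (hf : RectContinuous h T f)
    (hb : ∀ x : ℝ, HasDerivAt g (f (x + ((-h : ℝ) : ℂ) * I)) (x + ((-h : ℝ) : ℂ) * I))
    (ht : ∀ x : ℝ, HasDerivAt g (f (x + (h : ℂ) * I)) (x + (h : ℂ) * I))
    (hr : ∀ y : ℝ, HasDerivAt g (f (T + (y : ℂ) * I)) (T + (y : ℂ) * I))
    (hl : ∀ y : ℝ, HasDerivAt l (f (((-T : ℝ) : ℂ) + (y : ℂ) * I)) (((-T : ℝ) : ℂ) + (y : ℂ) * I)) :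
    rectIntegral h T f =
      (g (T + ((-h : ℝ) : ℂ) * I) - g (((-T : ℝ) : ℂ) + ((-h : ℝ) : ℂ) * I)) -
      (g (T + (h : ℂ) * I) - g (((-T : ℝ) : ℂ) + (h : ℂ) * I)) +
      (g (T + (h : ℂ) * I) - g (T + ((-h : ℝ) : ℂ) * I)) -
      (l (((-T : ℝ) : ℂ) + (h : ℂ) * I) - l (((-T : ℝ) : ℂ) + ((-h : ℝ) : ℂ) * I)) := by
  rw [rectIntegral, integral_horizontal_eq_sub hb hf.bottom, integral_horizontal_eq_sub ht hf.top,
    integral_vertical_eq_sub (fun y _ => hr y) hf.right,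
    integral_vertical_eq_sub (fun y _ => hl y) hf.left]

theorem rectIntegral_inv_pow_eq_zero {h T p : ℝ} (hh : 0 < h) (hp : |p| < T) (k : ℕ) :
    rectIntegral h T (fun w => ((w - p) ^ (k + 2))⁻¹) = 0 := by
  have hc : RectContinuous h T (fun w : ℂ => ((w - p) ^ (k + 2))⁻¹) := by
    refine .of_continuousOn hh hp ?_
    refine ContinuousOn.inv₀ (by fun_prop) fun w hw => pow_ne_zero _ (sub_ne_zero.mpr hw.2)
  have hT := abs_lt.mp hp
  have hd : ∀ w : ℂ, w ≠ p → HasDerivAt (fun w : ℂ => -((k + 1 : ℂ))⁻¹ * ((w - p) ^ (k + 1))⁻¹)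
      (((w - p) ^ (k + 2))⁻¹) w := by
    intro w hw
    have hw' := sub_ne_zero.mpr hw
    have hk : (k + 1 : ℂ) ≠ 0 := by exact_mod_cast Nat.succ_ne_zero k
    have h1 := (((hasDerivAt_id' w).sub_const (p : ℂ)).fun_pow (k + 1)).fun_inv (pow_ne_zero _ hw')
    refine (h1.const_mul (-((k + 1 : ℂ))⁻¹)).congr_deriv ?_
    push_cast
    field_simp
    ring
  have hne : ∀ x y : ℝ, (y ≠ 0 ∨ x ≠ p) → (x + y * I : ℂ) ≠ p := by
    intro x y hxy e
    have e1 := congrArg re e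
    have e2 := congrArg im e
    simp at e1 e2
    tauto
  rw [rectIntegral_eq_of_hasDerivAt hc (fun x => hd _ (hne _ _ (.inl (by linarith))))
    (fun x => hd _ (hne _ _ (.inl (by linarith)))) (fun y => hd _ (hne _ _ (.inr (by linarith))))
    (fun y => hd _ (hne _ _ (.inr (by linarith))))]
  ring

theorem log_neg_of_im_pos {z : ℂ} (hz : 0 < z.im) : log (-z) = log z - Real.pi * I := by
  simp only [log, norm_neg, arg_neg_eq_arg_sub_pi_of_im_pos hz, ofReal_sub]
  ring

theorem log_neg_of_im_neg {z : ℂ} (hz : z.im < 0) : log (-z) = log z + Real.pi * I := by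
  simp only [log, norm_neg, arg_neg_eq_arg_add_pi_of_im_neg hz, ofReal_add]
  ring

/-- The cut of `log (w - p)` meets the boundary only on the left edge, where `log (p - w)` is used
instead. At the lower and upper left corners the two logarithms differ by `-πi` and `πi`, which
accounts for `2πi`. -/
theorem rectIntegral_inv {h T p : ℝ} (hh : 0 < h) (hp : |p| < T) :
    rectIntegral h T (fun w => (w - p)⁻¹) = 2 * Real.pi * I := by
  have hc : RectContinuous h T (fun w : ℂ => (w - p)⁻¹) := by
    refine .of_continuousOn hh hp ?_
    refine ContinuousOn.inv₀ (by fun_prop) fun w hw => sub_ne_zero.mpr hw.2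
  have hT := abs_lt.mp hp
  have hd : ∀ w : ℂ, w - p ∈ slitPlane → HasDerivAt (fun w : ℂ => log (w - p)) ((w - p)⁻¹) w :=
    fun w hw => by simpa using ((hasDerivAt_id w).sub_const (p : ℂ)).clog hw
  have hd' : ∀ w : ℂ, p - w ∈ slitPlane → HasDerivAt (fun w : ℂ => log (p - w)) ((w - p)⁻¹) w := by
    intro w hw
    have := ((hasDerivAt_id' w).const_sub (p : ℂ)).clog hw
    refine this.congr_deriv ?_
    rw [← neg_sub (p : ℂ) w, inv_neg]; simp [div_eq_mul_inv]
  rw [rectIntegral_eq_of_hasDerivAt hc (fun x => hd _ (.inr (by simpa using hh.ne')))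
    (fun x => hd _ (.inr (by simpa using hh.ne'))) (fun y => hd _ (.inl (by simp; linarith)))
    (fun y => hd' _ (.inl (by simp; linarith)))]
  have e1 : (((-T : ℝ) : ℂ) + ((-h : ℝ) : ℂ) * I - p) = -(p - (((-T : ℝ) : ℂ) + ((-h : ℝ) : ℂ) * I)) := by
    ring
  have e2 : (((-T : ℝ) : ℂ) + h * I - p) = -(p - (((-T : ℝ) : ℂ) + h * I)) := by
    ring
  rw [e1, e2, log_neg_of_im_pos (by simpa using hh), log_neg_of_im_neg (by simpa using hh)]
  ring

/-- The residue theorem on a rectangle for a single pole on the real axis. -/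
theorem rectIntegral_div_pow {h T p : ℝ} (hh : 0 < h) (hp : |p| < T) {S : Set ℂ} (hS : IsOpen S)
    (hST : {w : ℂ | |w.im| ≤ h} ⊆ S) (m : ℕ) {F : ℂ → ℂ} (hF : DifferentiableOn ℂ F S) :
    rectIntegral h T (fun w => F w * ((w - p) ^ (m + 1))⁻¹) =
      2 * Real.pi * I * ((Function.swap dslope (p : ℂ))^[m] F) p := by
  have hpS : S ∈ 𝓝 (p : ℂ) := hS.mem_nhds (hST (by simpa using hh.le))
  have hc : ∀ k : ℕ, ∀ {G : ℂ → ℂ}, DifferentiableOn ℂ G S →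
      RectContinuous h T (fun w : ℂ => G w * ((w - p) ^ k)⁻¹) := by
    intro k G hG
    refine .of_continuousOn hh hp ((hG.continuousOn.mono fun w hw => hST hw.1).mul ?_)
    exact ContinuousOn.inv₀ (by fun_prop) fun w hw => pow_ne_zero _ (sub_ne_zero.mpr hw.2)
  have hT := abs_lt.mp hp
  -- Splitting off `G p` lowers the pole order by one and leaves the holomorphic quotient `dslope G
  -- p`. Powers of order at least two integrate to zero, so after `m` rounds only the simple pole
  -- contributes.
  have key : ∀ (k : ℕ) {G : ℂ → ℂ}, DifferentiableOn ℂ G S →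
      rectIntegral h T (fun w => G w * ((w - p) ^ (k + 1))⁻¹) =
        G p * rectIntegral h T (fun w => ((w - p) ^ (k + 1))⁻¹) +
        rectIntegral h T (fun w => dslope G p w * ((w - p) ^ k)⁻¹) := by
    intro k G hG
    rw [← rectIntegral_const_mul, ← rectIntegral_add]
    · have : ∀ w : ℂ, w ≠ p → G w * ((w - p) ^ (k + 1))⁻¹ =
          G p * ((w - p) ^ (k + 1))⁻¹ + dslope G p w * ((w - p) ^ k)⁻¹ := by
        intro w hw
        have hw' := sub_ne_zero.mpr hw
        rw [dslope_of_ne _ hw, slope_def_field]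
        field_simp
        ring
      have hne : ∀ x y : ℝ, (y ≠ 0 ∨ x ≠ p) → (x + y * I : ℂ) ≠ p := by
        intro x y hxy e
        have e1 := congrArg re e
        have e2 := congrArg im e
        simp at e1 e2
        tauto
      simp only [rectIntegral]
      congr 1
      · congr 1
        · congr 1
          · exact intervalIntegral.integral_congr fun x _ => this _ (hne _ _ (.inl (by linarith)))
          · exact intervalIntegral.integral_congr fun x _ => this _ (hne _ _ (.inl (by linarith)))
        · congr 1
          exact intervalIntegral.integral_congr fun x _ => this _ (hne _ _ (.inr (by linarith)))
      · congr 1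
        exact intervalIntegral.integral_congr fun x _ => this _ (hne _ _ (.inr (by linarith)))
    · exact hc (k + 1) (differentiableOn_const (G p))
    · exact hc k ((differentiableOn_dslope hpS).mpr hG)
  induction m generalizing F with
  | zero =>
    have h0 : rectIntegral h T (fun w => dslope F p w * ((w - p) ^ 0)⁻¹) = 0 := by
      simp only [pow_zero, inv_one, mul_one]
      refine rectIntegral_eq_zero (((differentiableOn_dslope hpS).mpr hF).mono fun w hw => hST ?_)
      have := hw.2
      rw [uIcc_of_le (by linarith)] at this
      exact abs_le.mpr this
    rw [key 0 hF, h0]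
    simp [rectIntegral_inv hh hp, mul_comm]
  | succ m ih =>
    rw [key (m + 1) hF, rectIntegral_inv_pow_eq_zero hh hp, ih ((differentiableOn_dslope hpS).mpr hF)]
    simp [Function.swap]

/-- Each `dslope` at `p` shifts the Taylor coefficients at `p` down by one. -/
theorem iterate_dslope_eq_iteratedDeriv {F : ℂ → ℂ} {p : ℂ} (hF : AnalyticAt ℂ F p) (m : ℕ) :
    ((Function.swap dslope p)^[m] F) p = iteratedDeriv m F p / m.factorial := by
  have h1 := hF.hasFPowerSeriesAt
  have h2 := (h1.has_fpower_series_iterate_dslope_fslope m).coeff_zero 1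
  rw [← h2]
  change ((FormalMultilinearSeries.fslope^[m]) _).coeff 0 = _
  rw [FormalMultilinearSeries.coeff_iterate_fslope, FormalMultilinearSeries.coeff_ofScalars]
  simp

/-! ### The Macdonald function as an integral. -/

/-- `∫_ℝ e^{-eᵘ - a e^{-u} + μu} du`, that is `2 a^{μ/2} K_μ(2√a)` for `a > 0`. -/
noncomputable def besselKInt (μ : ℂ) (a : ℝ) : ℂ :=
  ∫ u : ℝ, cexp (-(Real.exp u : ℂ) - a * (Real.exp (-u) : ℂ) + μ * u)

theorem norm_besselKInt_integrand (μ : ℂ) (a u : ℝ) :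
    ‖cexp (-(Real.exp u : ℂ) - a * (Real.exp (-u) : ℂ) + μ * u)‖ =
      Real.exp (-Real.exp u - a * Real.exp (-u) + μ.re * u) := by
  rw [Complex.norm_exp]
  congr 1
  rw [add_re, sub_re, neg_re, ofReal_re, ← ofReal_mul, ofReal_re, re_mul_ofReal]

theorem sq_div_two_le_exp_add_exp_neg (u : ℝ) : u ^ 2 / 2 ≤ Real.exp u + Real.exp (-u) := by
  rcases le_total 0 u with h | h
  · have := Real.quadratic_le_exp_of_nonneg h
    have := Real.exp_pos (-u)
    linarith
  · have := Real.quadratic_le_exp_of_nonneg (neg_nonneg.mpr h)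
    have := Real.exp_pos u
    nlinarith

theorem integrable_exp_neg_exp_sub {a : ℝ} (ha : 0 < a) (σ : ℝ) :
    Integrable fun u : ℝ => Real.exp (-Real.exp u - a * Real.exp (-u) + σ * u) := by
  set c := min 1 a with hc
  have hc0 : 0 < c := lt_min one_pos ha
  -- A Gaussian majorant, from `eᵘ + e⁻ᵘ ≥ u²/2`.
  have hg : Integrable fun u : ℝ => ‖cexp (-((c / 2 : ℝ) : ℂ) * u ^ 2 + (σ : ℂ) * u + 0)‖ :=
    (integrable_cexp_quadratic' (by simpa using half_pos hc0) _ _).norm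
  refine hg.mono' (by fun_prop) (.of_forall fun u => ?_)
  rw [Real.norm_of_nonneg (Real.exp_pos _).le, Complex.norm_exp]
  apply Real.exp_le_exp.mpr
  have h1 := sq_div_two_le_exp_add_exp_neg u
  have h2 : c * (Real.exp u + Real.exp (-u)) ≤ Real.exp u + a * Real.exp (-u) := by
    have h3 := mul_le_mul_of_nonneg_right (min_le_left 1 a) (Real.exp_pos u).le
    have h4 := mul_le_mul_of_nonneg_right (min_le_right 1 a) (Real.exp_pos (-u)).le
    rw [← hc] at h3 h4
    linarith
  have h5 := mul_le_mul_of_nonneg_left h1 hc0.le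
  have e : (-((c / 2 : ℝ) : ℂ) * (u : ℂ) ^ 2 + (σ : ℂ) * u + 0) =
      ((-(c / 2) * u ^ 2 + σ * u : ℝ) : ℂ) := by push_cast; ring
  rw [e, ofReal_re]
  linarith

theorem integrable_besselKInt {a : ℝ} (ha : 0 < a) (μ : ℂ) :
    Integrable fun u : ℝ => cexp (-(Real.exp u : ℂ) - a * (Real.exp (-u) : ℂ) + μ * u) := by
  refine (integrable_exp_neg_exp_sub ha μ.re).mono' (by fun_prop) (.of_forall fun u => ?_)
  rw [norm_besselKInt_integrand]

/-- The substitution `u ↦ log a - u` exchanges `eᵘ` and `a e⁻ᵘ`. -/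
theorem besselKInt_reflection {a : ℝ} (ha : 0 < a) (μ : ℂ) :
    besselKInt μ a = (a : ℂ) ^ μ * besselKInt (-μ) a := by
  rw [besselKInt, ← integral_sub_left_eq_self _ volume (Real.log a), besselKInt,
    ← integral_const_mul]
  congr 1 with u
  rw [cpow_def_of_ne_zero (by exact_mod_cast ha.ne'), ← Complex.exp_add, ← ofReal_log ha.le]
  have h1 : Real.exp (Real.log a - u) = a * Real.exp (-u) := by
    rw [sub_eq_add_neg, Real.exp_add, Real.exp_log ha]
  have h2 : a * Real.exp (-(Real.log a - u)) = Real.exp u := by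
    rw [neg_sub, Real.exp_sub, Real.exp_log ha]; field_simp
  rw [← ofReal_mul, h2, h1]
  congr 1
  push_cast
  ring

/-- The derivative in `u` of the integrand has integral zero over the line. -/
theorem besselKInt_recurrence {a : ℝ} (ha : 0 < a) (μ : ℂ) :
    μ * besselKInt μ a = besselKInt (μ + 1) a - a * besselKInt (μ - 1) a := by
  have h1 := integrable_besselKInt ha (μ + 1)
  have h2 := integrable_besselKInt ha (μ - 1)
  have h0 := integrable_besselKInt ha μ
  have key : ∫ u : ℝ, (μ * cexp (-(Real.exp u : ℂ) - a * (Real.exp (-u) : ℂ) + μ * u) -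
      (cexp (-(Real.exp u : ℂ) - a * (Real.exp (-u) : ℂ) + (μ + 1) * u) -
        a * cexp (-(Real.exp u : ℂ) - a * (Real.exp (-u) : ℂ) + (μ - 1) * u))) = 0 := by
    refine integral_eq_zero_of_hasDerivAt_of_integrable
      (f := fun u : ℝ => cexp (-(Real.exp u : ℂ) - a * (Real.exp (-u) : ℂ) + μ * u))
      (fun u => ?_) ((h0.const_mul _).sub (h1.sub (h2.const_mul _))) h0
    have d1 := (Real.hasDerivAt_exp u).ofReal_comp
    have d2 := ((Real.hasDerivAt_exp (-u)).comp u (hasDerivAt_neg u)).ofReal_comp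
    have d3 := (hasDerivAt_id u).ofReal_comp
    have := ((d1.neg.sub (d2.const_mul (a : ℂ))).add (d3.const_mul μ)).cexp
    refine this.congr_deriv ?_
    simp only [Pi.neg_apply, Pi.sub_apply, Pi.add_apply, Function.comp, id]
    have e1 : ∀ b : ℂ, cexp (b + (μ + 1) * u) = cexp (b + μ * u) * Real.exp u := by
      intro b; rw [ofReal_exp, ← Complex.exp_add]; ring_nf
    have e2 : ∀ b : ℂ, cexp (b + (μ - 1) * u) = cexp (b + μ * u) * Real.exp (-u) := by
      intro b; rw [ofReal_exp, ← Complex.exp_add]; push_cast; ring_nf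
    rw [e1, e2]
    push_cast
    ring
  have h3 : Integrable fun u : ℝ =>
      cexp (-(Real.exp u : ℂ) - a * (Real.exp (-u) : ℂ) + (μ + 1) * u) -
        a * cexp (-(Real.exp u : ℂ) - a * (Real.exp (-u) : ℂ) + (μ - 1) * u) :=
    h1.sub (h2.const_mul _)
  rw [integral_sub (h0.const_mul _) h3,
    integral_sub h1 (h2.const_mul _), integral_const_mul, integral_const_mul] at key
  exact sub_eq_zero.mp key

theorem hasDerivAt_besselKInt {a : ℝ} (ha : 0 < a) (μ : ℂ) :
    HasDerivAt (besselKInt (μ + 1)) (-besselKInt μ a) a := by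
  -- For `b > a/2` the derivative in `b` is dominated by its modulus at `a/2`.
  have hm : Ioi (a / 2) ∈ 𝓝 a := Ioi_mem_nhds (by linarith)
  have := hasDerivAt_integral_of_dominated_loc_of_deriv_le (μ := volume) (𝕜 := ℝ)
    (F := fun (b u : ℝ) => cexp (-(Real.exp u : ℂ) - b * (Real.exp (-u) : ℂ) + (μ + 1) * u))
    (F' := fun (b u : ℝ) => -cexp (-(Real.exp u : ℂ) - b * (Real.exp (-u) : ℂ) + μ * u))
    (bound := fun u => Real.exp (-Real.exp u - (a / 2) * Real.exp (-u) + μ.re * u))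
    (x₀ := a) hm (.of_forall fun b => by fun_prop) (integrable_besselKInt ha _) (by fun_prop)
    (.of_forall fun u b hb => ?_) (integrable_exp_neg_exp_sub (half_pos ha) _)
    (.of_forall fun u b hb => ?_)
  · refine this.2.congr_deriv ?_
    rw [integral_neg, besselKInt]
  · rw [norm_neg, norm_besselKInt_integrand]
    apply Real.exp_le_exp.mpr
    have := mul_le_mul_of_nonneg_right (le_of_lt (mem_Ioi.mp hb)) (Real.exp_pos (-u)).le
    linarith
  · have d1 := (((hasDerivAt_id b).ofReal_comp.mul_const (Real.exp (-u) : ℂ)).const_sub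
      (-(Real.exp u : ℂ))).add_const ((μ + 1) * u)
    refine d1.cexp.congr_deriv ?_
    have e1 : ∀ c : ℂ, cexp (c + (μ + 1) * u) * Real.exp (-u) = cexp (c + μ * u) := by
      intro b; rw [ofReal_exp, ← Complex.exp_add]; push_cast; ring_nf
    rw [← e1]
    simp

theorem integrable_exp_neg_exp {σ : ℝ} (hσ : 0 < σ) :
    Integrable fun u : ℝ => Real.exp (-Real.exp u + σ * u) := by
  have h := Real.GammaIntegral_convergent hσ
  have hr : Real.exp '' univ = Ioi 0 := by rw [image_univ, Real.range_exp]
  rw [← hr, integrableOn_image_iff_integrableOn_abs_deriv_smul MeasurableSet.univ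
    (fun x _ => (Real.hasDerivAt_exp x).hasDerivWithinAt) Real.exp_injective.injOn,
    integrableOn_univ] at h
  refine h.congr (.of_forall fun u => ?_)
  simp only [smul_eq_mul, abs_of_pos (Real.exp_pos u)]
  rw [Real.rpow_def_of_pos (Real.exp_pos u), Real.log_exp, ← Real.exp_add, ← Real.exp_add]
  congr 1
  ring

theorem Gamma_eq_integral_exp {μ : ℂ} (hμ : 0 < μ.re) :
    Complex.Gamma μ = ∫ u : ℝ, cexp (-(Real.exp u : ℂ) + μ * u) := by
  have hr : Real.exp '' univ = Ioi 0 := by rw [image_univ, Real.range_exp]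
  rw [Gamma_eq_integral hμ, Complex.GammaIntegral, ← hr, integral_image_eq_integral_abs_deriv_smul
    MeasurableSet.univ (fun x _ => (Real.hasDerivAt_exp x).hasDerivWithinAt)
    Real.exp_injective.injOn, setIntegral_univ]
  congr 1 with u
  have h0 : (Real.exp u : ℂ) ≠ 0 := by exact_mod_cast (Real.exp_pos u).ne'
  rw [cpow_def_of_ne_zero h0, ← ofReal_log (Real.exp_pos u).le, Real.log_exp,
    abs_of_pos (Real.exp_pos u), real_smul]
  push_cast
  rw [← Complex.exp_add, ← Complex.exp_add]
  congr 1
  ring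

/-- As `a → 0+` the integrand becomes that of Euler's integral in the variable `x = eᵘ`; `Re μ > 0`
makes this limit an integrable majorant. -/
theorem tendsto_besselKInt {μ : ℂ} (hμ : 0 < μ.re) :
    Tendsto (besselKInt μ) (𝓝[>] 0) (𝓝 (Complex.Gamma μ)) := by
  rw [Gamma_eq_integral_exp hμ]
  refine tendsto_integral_filter_of_dominated_convergence
    (fun u => Real.exp (-Real.exp u + μ.re * u)) (.of_forall fun a => by fun_prop) ?_
    (integrable_exp_neg_exp hμ) (.of_forall fun u => ?_)
  · filter_upwards [self_mem_nhdsWithin] with a ha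
    refine .of_forall fun u => ?_
    rw [norm_besselKInt_integrand]
    apply Real.exp_le_exp.mpr
    have := mul_pos (mem_Ioi.mp ha) (Real.exp_pos (-u))
    linarith
  · have : Continuous fun a : ℝ =>
        cexp (-(Real.exp u : ℂ) - a * (Real.exp (-u) : ℂ) + μ * u) := by fun_prop
    have h := (this.tendsto 0).mono_left (nhdsWithin_le_nhds (s := Ioi 0))
    simpa using h

/-! ### The modified Bessel series and the connection formula. -/

/-- `∑ₖ zᵏ / (k! Γ(μ+k+1))`, the entire factor of the modified Bessel function of the first kind. -/
noncomputable def besselSeries (μ z : ℂ) : ℂ :=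
  ∑' k : ℕ, z ^ k / (k.factorial : ℂ) * (Complex.Gamma (μ + k + 1))⁻¹

theorem inv_Gamma_eq_mul_inv_Gamma_add_one (s : ℂ) :
    (Complex.Gamma s)⁻¹ = s * (Complex.Gamma (s + 1))⁻¹ := one_div_Gamma_eq_self_mul_one_div_Gamma_add_one s

/-- By `1/Γ(s) = s/Γ(s+1)` the modulus of `1/Γ(μ+k+1)` does not increase once `k ≥ ‖μ‖`, since then
`‖μ+k+1‖ ≥ 1`. -/
theorem exists_bound_inv_Gamma (μ : ℂ) :
    ∃ C : ℝ, 0 ≤ C ∧ ∀ k : ℕ, ‖(Complex.Gamma (μ + k + 1))⁻¹‖ ≤ C := by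
  obtain ⟨n, hn⟩ := exists_nat_ge (‖μ‖)
  have hdec : ∀ j : ℕ, ‖(Complex.Gamma (μ + (n + j : ℕ) + 1))⁻¹‖ ≤
      ‖(Complex.Gamma (μ + n + 1))⁻¹‖ := by
    intro j
    induction j with
    | zero => simp
    | succ j ih =>
      refine le_trans ?_ ih
      rw [inv_Gamma_eq_mul_inv_Gamma_add_one (μ + (n + j : ℕ) + 1), norm_mul]
      have h1 : 1 ≤ ‖μ + (n + j : ℕ) + 1‖ := by
        have h2 : ‖((n + j + 1 : ℕ) : ℂ)‖ ≤ ‖μ + (n + j : ℕ) + 1‖ + ‖μ‖ := by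
          calc _ = ‖(μ + (n + j : ℕ) + 1) - μ‖ := by congr 1; push_cast; ring
            _ ≤ _ := norm_sub_le _ _
        rw [Complex.norm_natCast] at h2
        push_cast at h2 ⊢
        have : (0 : ℝ) ≤ j := j.cast_nonneg
        linarith
      have e : μ + (n + (j + 1) : ℕ) + 1 = μ + (n + j : ℕ) + 1 + 1 := by push_cast; ring
      rw [e]
      exact le_mul_of_one_le_left (norm_nonneg _) h1
  refine ⟨(∑ k ∈ Finset.range n, ‖(Complex.Gamma (μ + k + 1))⁻¹‖) + ‖(Complex.Gamma (μ + n + 1))⁻¹‖,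
    by positivity, fun k => ?_⟩
  rcases lt_or_ge k n with hk | hk
  · have := Finset.single_le_sum (f := fun k : ℕ => ‖(Complex.Gamma (μ + k + 1))⁻¹‖)
      (fun i _ => norm_nonneg _) (Finset.mem_range.mpr hk)
    exact this.trans (le_add_of_nonneg_right (norm_nonneg _))
  · obtain ⟨j, rfl⟩ := Nat.exists_eq_add_of_le hk
    exact (hdec j).trans (le_add_of_nonneg_left (Finset.sum_nonneg fun _ _ => norm_nonneg _))

theorem summable_besselSeries (μ z : ℂ) :
    Summable fun k : ℕ => z ^ k / (k.factorial : ℂ) * (Complex.Gamma (μ + k + 1))⁻¹ := by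
  obtain ⟨C, -, hC⟩ := exists_bound_inv_Gamma μ
  refine .of_norm_bounded ((Real.summable_pow_div_factorial ‖z‖).mul_right C) fun k => ?_
  rw [norm_mul, norm_div, norm_pow, Complex.norm_natCast]
  gcongr
  exact hC k

theorem besselSeries_term_succ (μ z : ℂ) (k : ℕ) :
    ((k + 1 : ℕ) : ℂ) * z ^ k / ((k + 1).factorial : ℂ) * (Complex.Gamma (μ + (k + 1 : ℕ) + 1))⁻¹ =
      z ^ k / (k.factorial : ℂ) * (Complex.Gamma (μ + 1 + k + 1))⁻¹ := by
  have e : μ + (k + 1 : ℕ) + 1 = μ + 1 + k + 1 := by push_cast; ring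
  have h1 : ((k + 1 : ℕ) : ℂ) ≠ 0 := by exact_mod_cast k.succ_ne_zero
  have h2 : (k.factorial : ℂ) ≠ 0 := by exact_mod_cast k.factorial_ne_zero
  rw [e, Nat.factorial_succ, Nat.cast_mul]
  congr 1
  field_simp

theorem hasDerivAt_besselSeries (μ z : ℂ) :
    HasDerivAt (besselSeries μ) (besselSeries (μ + 1) z) z := by
  obtain ⟨C, hC0, hC⟩ := exists_bound_inv_Gamma μ
  have hz : z ∈ Metric.ball (0 : ℂ) (‖z‖ + 1) := by simp
  have hu : Summable fun k : ℕ => (k : ℝ) * (‖z‖ + 1) ^ (k - 1) / (k.factorial : ℝ) * C := by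
    rw [← summable_nat_add_iff 1]
    refine ((Real.summable_pow_div_factorial (‖z‖ + 1)).mul_right C).congr fun k => ?_
    have h1 : (k + 1 : ℝ) ≠ 0 := by positivity
    have h2 : (k.factorial : ℝ) ≠ 0 := by positivity
    simp only [Nat.add_sub_cancel, Nat.factorial_succ, Nat.cast_mul, Nat.cast_add, Nat.cast_one]
    field_simp
  have hb : ∀ (k : ℕ), ∀ y ∈ Metric.ball (0 : ℂ) (‖z‖ + 1),
      ‖(k : ℂ) * y ^ (k - 1) / (k.factorial : ℂ) * (Complex.Gamma (μ + k + 1))⁻¹‖ ≤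
        (k : ℝ) * (‖z‖ + 1) ^ (k - 1) / (k.factorial : ℝ) * C := by
    intro k y hy
    rw [norm_mul, norm_div, norm_mul, norm_pow, Complex.norm_natCast, Complex.norm_natCast]
    have hy' : ‖y‖ ≤ ‖z‖ + 1 := by simpa using (mem_ball_zero_iff.mp hy).le
    gcongr
    exact hC k
  have key := hasDerivAt_tsum_of_isPreconnected hu Metric.isOpen_ball
    (convex_ball _ _).isPreconnected
    (g := fun (k : ℕ) (y : ℂ) => y ^ k / (k.factorial : ℂ) * (Complex.Gamma (μ + k + 1))⁻¹)
    (fun k y _ => ((hasDerivAt_pow k y).div_const _).mul_const _) hb hz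
    (summable_besselSeries μ z) hz
  refine key.congr_deriv ?_
  have hs := Summable.of_norm_bounded hu fun k => hb k z hz
  rw [hs.tsum_eq_zero_add, besselSeries]
  simp only [Nat.cast_zero, zero_mul, zero_div, zero_add]
  exact tsum_congr fun k => by
    simpa only [Nat.add_sub_cancel] using besselSeries_term_succ μ z k

theorem besselSeries_zero (μ : ℂ) : besselSeries μ 0 = (Complex.Gamma (μ + 1))⁻¹ := by
  rw [besselSeries, tsum_eq_single 0 fun k hk => by simp [hk]]
  simp

/-- Termwise `1/Γ(μ+k) = (μ+k)/Γ(μ+k+1)`; the part with factor `k` is `z` times the series of order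
`μ + 1` after an index shift. -/
theorem besselSeries_recurrence (μ z : ℂ) :
    besselSeries (μ - 1) z = μ * besselSeries μ z + z * besselSeries (μ + 1) z := by
  have h1 := summable_besselSeries μ z
  have h2 : z * besselSeries (μ + 1) z =
      ∑' k : ℕ, (k : ℂ) * (z ^ k / (k.factorial : ℂ) * (Complex.Gamma (μ + k + 1))⁻¹) := by
    have hs : Summable fun k : ℕ =>
        (k : ℂ) * (z ^ k / (k.factorial : ℂ) * (Complex.Gamma (μ + k + 1))⁻¹) := by
      rw [← summable_nat_add_iff 1]
      refine ((summable_besselSeries (μ + 1) z).mul_left z).congr fun k => ?_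
      rw [← besselSeries_term_succ]
      ring
    rw [hs.tsum_eq_zero_add, besselSeries, ← tsum_mul_left]
    simp only [Nat.cast_zero, zero_mul, zero_add]
    refine tsum_congr fun k => ?_
    rw [← besselSeries_term_succ]
    ring
  have hs : Summable fun k : ℕ =>
        (k : ℂ) * (z ^ k / (k.factorial : ℂ) * (Complex.Gamma (μ + k + 1))⁻¹) := by
    have := (summable_besselSeries (μ - 1) z).sub (h1.mul_left μ)
    refine this.congr fun k => ?_
    rw [inv_Gamma_eq_mul_inv_Gamma_add_one (μ - 1 + k + 1)]
    have : μ - 1 + k + 1 = μ + k := by ring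
    rw [this]
    ring
  rw [h2, besselSeries, besselSeries, ← tsum_mul_left, ← (h1.mul_left μ).tsum_add hs]
  refine tsum_congr fun k => ?_
  rw [inv_Gamma_eq_mul_inv_Gamma_add_one (μ - 1 + k + 1)]
  have : μ - 1 + k + 1 = μ + k := by ring
  rw [this]
  ring

/-- The connection formula value `π / sin(πμ) · (I-series of order -μ minus that of order μ)`. -/
noncomputable def besselKSeries (μ : ℂ) (a : ℝ) : ℂ :=
  Real.pi / Complex.sin (Real.pi * μ) * (besselSeries (-μ) a - (a : ℂ) ^ μ * besselSeries μ a)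

theorem besselKSeries_reflection {a : ℝ} (ha : 0 < a) (μ : ℂ) :
    besselKSeries μ a = (a : ℂ) ^ μ * besselKSeries (-μ) a := by
  have h0 : (a : ℂ) ≠ 0 := by exact_mod_cast ha.ne'
  have h1 : (a : ℂ) ^ μ * (a : ℂ) ^ (-μ) = 1 := by rw [← cpow_add _ _ h0]; simp
  simp only [besselKSeries, neg_neg, mul_neg, Complex.sin_neg, div_neg]
  linear_combination (-(Real.pi : ℂ) / Complex.sin (Real.pi * μ) * besselSeries (-μ) a) * h1

theorem sin_pi_mul_add_one (μ : ℂ) :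
    Complex.sin (Real.pi * (μ + 1)) = -Complex.sin (Real.pi * μ) := by
  rw [mul_add, mul_one, Complex.sin_add_pi]

theorem besselKSeries_recurrence {a : ℝ} (ha : 0 < a) (μ : ℂ) :
    μ * besselKSeries μ a = besselKSeries (μ + 1) a - a * besselKSeries (μ - 1) a := by
  have h0 : (a : ℂ) ≠ 0 := by exact_mod_cast ha.ne'
  have h1 := sin_pi_mul_add_one μ
  have h2 := sin_pi_mul_add_one (μ - 1)
  have h3 := besselSeries_recurrence μ a
  have h4 := besselSeries_recurrence (-μ) a
  have e1 : -μ - 1 = -(μ + 1) := by ring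
  have e2 : -μ + 1 = -(μ - 1) := by ring
  rw [e1, e2] at h4
  rw [sub_add_cancel] at h2
  have h5 : (a : ℂ) ^ (μ + 1) = (a : ℂ) ^ μ * a := by rw [cpow_add _ _ h0, cpow_one]
  have h6 : (a : ℂ) * (a : ℂ) ^ (μ - 1) = (a : ℂ) ^ μ := by
    rw [cpow_sub _ _ h0, cpow_one]; field_simp
  have h7 : Complex.sin (Real.pi * (μ - 1)) = -Complex.sin (Real.pi * μ) := by rw [h2, neg_neg]
  simp only [besselKSeries, h1, h7, div_neg]
  rw [h4, h3, h5]
  linear_combination ((Real.pi : ℂ) / Complex.sin (Real.pi * μ) *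
    (μ * besselSeries μ a + a * besselSeries (μ + 1) a)) * h6

theorem hasDerivAt_besselKSeries {a : ℝ} (ha : 0 < a) (μ : ℂ) :
    HasDerivAt (besselKSeries (μ + 1)) (-besselKSeries μ a) a := by
  have h0 : (a : ℂ) ≠ 0 := by exact_mod_cast ha.ne'
  have d1 := (hasDerivAt_besselSeries (-(μ + 1)) a).comp_ofReal
  have d2 := (hasDerivAt_besselSeries (μ + 1) a).comp_ofReal
  have d3 : HasDerivAt (fun b : ℝ => (b : ℂ) ^ (μ + 1)) ((μ + 1) * (a : ℂ) ^ μ) a := by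
    have := ((hasDerivAt_id (a : ℂ)).cpow_const (c := μ + 1) (by simpa using ha)).comp_ofReal
    simpa using this
  refine ((d1.sub (d3.mul d2)).const_mul
    ((Real.pi : ℂ) / Complex.sin (Real.pi * (μ + 1)))).congr_deriv ?_
  have h3 := besselSeries_recurrence (μ + 1) a
  rw [add_sub_cancel_right] at h3
  have e : -(μ + 1) + 1 = -μ := by ring
  have h5 : (a : ℂ) ^ (μ + 1) = (a : ℂ) ^ μ * a := by rw [cpow_add _ _ h0, cpow_one]
  simp only [besselKSeries, sin_pi_mul_add_one, div_neg]
  rw [e, h5, h3]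
  ring

/-- The factor `a^μ` kills the series of order `μ`; the other tends to `1/Γ(1-μ)`, and Euler's
reflection formula gives `Γ(μ)`. -/
theorem tendsto_besselKSeries {μ : ℂ} (hμ : 0 < μ.re) (hs : Complex.sin (Real.pi * μ) ≠ 0) :
    Tendsto (besselKSeries μ) (𝓝[>] 0) (𝓝 (Complex.Gamma μ)) := by
  have hG := Complex.Gamma_mul_Gamma_one_sub μ
  have hne : Complex.Gamma (1 - μ) ≠ 0 := by
    intro h
    rw [h, mul_zero] at hG
    exact div_ne_zero (by exact_mod_cast Real.pi_ne_zero) hs hG.symm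
  have t : ∀ κ : ℂ, Tendsto (fun a : ℝ => besselSeries κ a) (𝓝[>] 0) (𝓝 (besselSeries κ 0)) := by
    intro κ
    have := (hasDerivAt_besselSeries κ (0 : ℝ)).comp_ofReal.continuousAt.tendsto
    simpa using this.mono_left (nhdsWithin_le_nhds (s := Ioi 0))
  have t2 : Tendsto (fun a : ℝ => (a : ℂ) ^ μ) (𝓝[>] 0) (𝓝 0) := by
    have h1 := (continuousAt_cpow_const_of_re_pos (z := 0) (w := μ) (.inl le_rfl) hμ).tendsto
    rw [zero_cpow (by rintro rfl; simp at hμ)] at h1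
    have h2 : Tendsto (fun a : ℝ => (a : ℂ)) (𝓝[>] 0) (𝓝 0) := by
      simpa using (continuous_ofReal.tendsto 0).mono_left (nhdsWithin_le_nhds (s := Ioi 0))
    exact h1.comp h2
  have := ((t (-μ)).sub (t2.mul (t μ))).const_mul ((Real.pi : ℂ) / Complex.sin (Real.pi * μ))
  refine this.trans (le_of_eq ?_)
  congr 1
  rw [zero_mul, sub_zero, besselSeries_zero, ← hG]
  have : -μ + 1 = 1 - μ := by ring
  rw [this]
  field_simp

/-! ### Uniqueness, and the Hankel function at imaginary order. -/

/-- A family satisfying the differential-difference relations of `besselKInt` which vanishes at `0+`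
for orders `1 ± ν` vanishes at the purely imaginary order `ν`. -/
theorem eq_zero_of_bessel_relations {D : ℂ → ℝ → ℂ}
    (hd : ∀ μ a, 0 < a → HasDerivAt (D (μ + 1)) (-D μ a) a)
    (hrec : ∀ μ a, 0 < a → μ * D μ a = D (μ + 1) a - a * D (μ - 1) a)
    (hrefl : ∀ μ a, 0 < a → D μ a = (a : ℂ) ^ μ * D (-μ) a)
    {ν : ℂ} (hν : ν ≠ 0) (hre : ν.re = 0)
    (hp : Tendsto (D (ν + 1)) (𝓝[>] 0) (𝓝 0)) (hq : Tendsto (D (-ν + 1)) (𝓝[>] 0) (𝓝 0))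
    {a : ℝ} (ha : 0 < a) : D ν a = 0 := by
  have hnorm : ∀ b : ℝ, 0 < b → ‖(b : ℂ) ^ ν‖ = 1 := fun b hb => by
    rw [norm_cpow_eq_rpow_re_of_pos hb, hre, Real.rpow_zero]
  set f : ℝ → ℂ × ℂ := fun b => (D (ν + 1) b, D (-ν + 1) b) with hf
  set f' : ℝ → ℂ × ℂ := fun b => (-D ν b, -D (-ν) b)
  have hν' : 0 < ‖ν‖ := norm_pos_iff.mpr hν
  -- Reflection replaces the order `ν - 1` by `1 - ν`, so `D ν` is a combination of the two
  -- components of `f`. As `|b^ν| = 1`, the system has a Lipschitz bound `2/‖ν‖` uniform down to `b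
  -- = 0`.
  have hsol : ∀ b : ℝ, 0 < b → ν * D ν b = D (ν + 1) b - (b : ℂ) ^ ν * D (-ν + 1) b := by
    intro b hb
    have h0 : (b : ℂ) ≠ 0 := by exact_mod_cast hb.ne'
    have e : -(ν - 1) = -ν + 1 := by ring
    have h6 : (b : ℂ) * (b : ℂ) ^ (ν - 1) = (b : ℂ) ^ ν := by
      rw [cpow_sub _ _ h0, cpow_one]; field_simp
    rw [hrec ν b hb, hrefl (ν - 1) b hb, e, ← h6]
    ring
  have hD : ∀ b : ℝ, 0 < b → ‖D ν b‖ ≤ 2 / ‖ν‖ * ‖f b‖ := by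
    intro b hb
    have h1 : ‖ν‖ * ‖D ν b‖ ≤ ‖D (ν + 1) b‖ + ‖D (-ν + 1) b‖ := by
      rw [← norm_mul, hsol b hb]
      refine (norm_sub_le _ _).trans ?_
      rw [norm_mul, hnorm b hb, one_mul]
    have h2 : ‖D (ν + 1) b‖ ≤ ‖f b‖ := norm_fst_le (f b)
    have h3 : ‖D (-ν + 1) b‖ ≤ ‖f b‖ := norm_snd_le (f b)
    rw [div_mul_eq_mul_div, le_div_iff₀ hν']
    linarith
  have hder : ∀ b : ℝ, 0 < b → HasDerivAt f (f' b) b := fun b hb =>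
    (hd ν b hb).prodMk (hd (-ν) b hb)
  have hbound : ∀ b : ℝ, 0 < b → ‖f' b‖ ≤ 2 / ‖ν‖ * ‖f b‖ + 0 := by
    intro b hb
    have h1 : ‖D (-ν) b‖ = ‖D ν b‖ := by rw [hrefl ν b hb, norm_mul, hnorm b hb, one_mul]
    rw [add_zero, Prod.norm_def]
    simp only [f', norm_neg, h1, max_self]
    exact hD b hb
  -- Grönwall on `[δ, a]`, with a factor independent of `δ`; then `δ → 0+`.
  have hgr : ∀ δ : ℝ, 0 < δ → δ ≤ a → ‖f a‖ ≤ ‖f δ‖ * Real.exp (2 / ‖ν‖ * a) := by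
    intro δ hδ hδa
    have := norm_le_gronwallBound_of_norm_deriv_right_le (f := f) (f' := f') (δ := ‖f δ‖)
      (a := δ) (b := a)
      (fun b hb => (hder b (hδ.trans_le hb.1)).continuousAt.continuousWithinAt)
      (fun b hb => (hder b (hδ.trans_le hb.1)).hasDerivWithinAt) le_rfl
      (fun b hb => hbound b (hδ.trans_le hb.1)) a ⟨hδa, le_rfl⟩
    rw [gronwallBound_ε0] at this
    refine this.trans ?_
    gcongr
    linarith
  have ht : Tendsto (fun δ => ‖f δ‖ * Real.exp (2 / ‖ν‖ * a)) (𝓝[>] 0) (𝓝 0) := by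
    have h : Tendsto f (𝓝[>] 0) (𝓝 0) := hp.prodMk_nhds hq
    simpa only [norm_zero, zero_mul] using h.norm.mul_const (Real.exp (2 / ‖ν‖ * a))
  have hfa : ‖f a‖ ≤ 0 := by
    refine ge_of_tendsto ht ?_
    filter_upwards [Ioc_mem_nhdsGT ha] with δ hδ using hgr δ hδ.1 hδ.2
  have := hD a ha
  rw [le_antisymm hfa (norm_nonneg _), mul_zero] at this
  exact norm_le_zero_iff.mp this

theorem sin_pi_mul_ne_zero_of_im_ne_zero {μ : ℂ} (h : μ.im ≠ 0) :
    Complex.sin (Real.pi * μ) ≠ 0 := by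
  rw [Complex.sin_ne_zero_iff]
  intro k hk
  have := congrArg Complex.im hk
  simp [Real.pi_ne_zero, h] at this

/-- The uniqueness statement is applied to the difference. Orders `1 ± ν` serve as initial data
because both sides tend to `Γ(1 ± ν)` there, whereas at the imaginary order `ν` they oscillate as `a
→ 0+`. -/
theorem besselKInt_eq_besselKSeries {ν : ℂ} (hre : ν.re = 0) (him : ν.im ≠ 0) {a : ℝ} (ha : 0 < a) :
    besselKInt ν a = besselKSeries ν a := by
  have hlim : ∀ {μ : ℂ}, 0 < μ.re → μ.im ≠ 0 →
      Tendsto (fun a => besselKInt μ a - besselKSeries μ a) (𝓝[>] 0) (𝓝 0) := by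
    intro μ h1 h2
    simpa using (tendsto_besselKInt h1).sub
      (tendsto_besselKSeries h1 (sin_pi_mul_ne_zero_of_im_ne_zero h2))
  refine sub_eq_zero.mp (eq_zero_of_bessel_relations
    (D := fun μ a => besselKInt μ a - besselKSeries μ a) (ν := ν) ?_ ?_ ?_ ?_ hre ?_ ?_ ha)
  · intro μ a ha
    exact ((hasDerivAt_besselKInt ha μ).sub (hasDerivAt_besselKSeries ha μ)).congr_deriv (by ring)
  · intro μ a ha
    linear_combination besselKInt_recurrence ha μ - besselKSeries_recurrence ha μ
  · intro μ a ha
    linear_combination besselKInt_reflection ha μ - besselKSeries_reflection ha μ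
  · rintro rfl
    simp at him
  · exact hlim (by simp [hre]) (by simpa using him)
  · exact hlim (by simp [hre]) (by simpa using him)

/-- The shift `u ↦ u + log ε` balances the two exponentials into `2ε cosh u`. -/
theorem besselKInt_sq {ε : ℝ} (hε : 0 < ε) (ν : ℂ) :
    besselKInt ν (ε ^ 2) = (ε : ℂ) ^ ν * ∫ u : ℝ, cexp (-(2 * ε * Real.cosh u : ℝ) + ν * u) := by
  rw [besselKInt, ← integral_add_right_eq_self _ (Real.log ε), ← integral_const_mul]
  congr 1 with u
  rw [cpow_def_of_ne_zero (by exact_mod_cast hε.ne'), ← Complex.exp_add, ← ofReal_log hε.le]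
  have h1 : Real.exp (u + Real.log ε) = ε * Real.exp u := by
    rw [Real.exp_add, Real.exp_log hε, mul_comm]
  have h2 : ε ^ 2 * Real.exp (-(u + Real.log ε)) = ε * Real.exp (-u) := by
    rw [neg_add, Real.exp_add, Real.exp_neg (Real.log ε), Real.exp_log hε]; field_simp
  rw [← ofReal_mul, h2, h1, Real.cosh_eq]
  congr 1
  push_cast
  ring

theorem besselJ_mul_I {ε : ℝ} (hε : 0 < ε) (ν : ℂ) :
    besselJ ν (2 * ε * I) =
      cexp (Real.pi * I / 2 * ν) * (ε : ℂ) ^ ν * besselSeries ν ((ε ^ 2 : ℝ) : ℂ) := by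
  have e1 : (2 * ε * I / 2 : ℂ) = ε * I := by ring
  have e2 : ((2 * ε * I) ^ 2 / 4 : ℂ) = -((ε ^ 2 : ℝ) : ℂ) := by
    push_cast; linear_combination (ε : ℂ) ^ 2 * I_sq
  rw [besselJ, e1, e2, besselSeries]
  congr 1
  · have hε0 : (ε : ℂ) ≠ 0 := by exact_mod_cast hε.ne'
    rw [cpow_def_of_ne_zero (mul_ne_zero hε0 I_ne_zero), log_ofReal_mul hε I_ne_zero, log_I,
      cpow_def_of_ne_zero hε0, ← Complex.exp_add, ofReal_log hε.le]
    congr 1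
    ring
  · refine tsum_congr fun k => ?_
    rw [← mul_pow, neg_one_mul, neg_neg]

theorem hankelH1_imaginary {lam x : ℝ} (hlam : 0 < lam) (hx : 0 < x) :
    cexp (-(Real.pi : ℂ) * x) * (I * hankelH1 (I * x) (lam * I * x)) =
      1 / (Real.pi : ℂ) *
        ∫ u : ℝ, cexp (-(x : ℂ) * (Real.pi / 2 + lam * (Real.cosh u : ℂ) - u * I)) := by
  set ν : ℂ := I * x with hν
  set ε : ℝ := lam * x / 2 with hεd
  have hε : 0 < ε := by positivity
  have him : ν.im ≠ 0 := by simpa [hν] using hx.ne'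
  have hre : ν.re = 0 := by simp [hν]
  have hs : Complex.sin (Real.pi * ν) ≠ 0 := sin_pi_mul_ne_zero_of_im_ne_zero him
  have hz : (lam * I * x : ℂ) = 2 * ε * I := by rw [hεd]; push_cast; ring
  -- The order is not an integer, so `besselY` is the plain quotient.
  have hint : ¬ ∃ m : ℤ, ν = m := by
    rintro ⟨m, hm⟩
    exact him (by rw [hm]; simp)
  have hε0 : (ε : ℂ) ≠ 0 := by exact_mod_cast hε.ne'
  have hpi : (Real.pi : ℂ) ≠ 0 := by exact_mod_cast Real.pi_ne_zero
  have hpow : (ε : ℂ) ^ ν * (ε : ℂ) ^ (-ν) = 1 := by rw [← cpow_add _ _ hε0]; simp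
  have hpow2 : ((ε ^ 2 : ℝ) : ℂ) ^ ν = (ε : ℂ) ^ ν * (ε : ℂ) ^ ν := by
    rw [← mul_cpow_ofReal_nonneg hε.le hε.le]; push_cast; rw [sq]
  have hK := besselKInt_sq hε ν
  rw [besselKInt_eq_besselKSeries hre him (pow_pos hε 2), besselKSeries, hpow2] at hK
  set A := besselSeries (-ν) ((ε ^ 2 : ℝ) : ℂ)
  set B := besselSeries ν ((ε ^ 2 : ℝ) : ℂ)
  set q : ℂ := cexp (-(Real.pi : ℂ) * x / 2) with hq
  have hq0 : q ≠ 0 := Complex.exp_ne_zero _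
  have hJ1 : besselJ ν (2 * ε * I) = q * (ε : ℂ) ^ ν * B := by
    rw [besselJ_mul_I hε]
    congr 3
    rw [hν]; linear_combination (Real.pi * x / 2 : ℂ) * I_sq
  have hJ2 : besselJ (-ν) (2 * ε * I) = q⁻¹ * (ε : ℂ) ^ (-ν) * A := by
    rw [besselJ_mul_I hε, hq, ← Complex.exp_neg]
    congr 3
    rw [hν]; linear_combination (-(Real.pi * x / 2 : ℂ)) * I_sq
  have hqq : cexp (-(Real.pi : ℂ) * x) = q * q := by
    rw [hq, ← Complex.exp_add]; congr 1; ring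
  -- This is `e^{-iπν} = e^{πx}`; it combines the two `J` terms of the Hankel function into the
  -- connection formula.
  have hcs : Complex.cos (Real.pi * ν) - Complex.sin (Real.pi * ν) * I = q⁻¹ * q⁻¹ := by
    have h := Complex.exp_mul_I (-(Real.pi * ν))
    rw [Complex.cos_neg, Complex.sin_neg] at h
    rw [← mul_inv, ← hqq, ← Complex.exp_neg, sub_eq_add_neg, ← neg_mul, ← h, hν]
    congr 1
    linear_combination (-(Real.pi * x : ℂ)) * I_sq
  have hI : (∫ u : ℝ, cexp (-(x : ℂ) * (Real.pi / 2 + lam * (Real.cosh u : ℂ) - u * I))) =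
      q * ∫ u : ℝ, cexp (-(2 * ε * Real.cosh u : ℝ) + ν * u) := by
    rw [← integral_const_mul]
    congr 1 with u
    rw [hq, ← Complex.exp_add, hεd, hν]
    congr 1
    push_cast
    ring
  rw [hI, hz, hankelH1, besselY, if_neg hint, besselYQuotient, hJ1, hJ2, hqq, mul_comm ν]
  set J := ∫ u : ℝ, cexp (-(2 * ε * Real.cosh u : ℝ) + ν * u)
  have hJ : J = Real.pi / Complex.sin (Real.pi * ν) * ((ε : ℂ) ^ (-ν) * A - (ε : ℂ) ^ ν * B) := by
    linear_combination (-(ε : ℂ) ^ (-ν)) * hK - (J + Real.pi / Complex.sin (Real.pi * ν) *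
      (ε : ℂ) ^ ν * B) * hpow
  have hcos : Complex.cos (Real.pi * ν) = q⁻¹ * q⁻¹ + Complex.sin (Real.pi * ν) * I := by
    linear_combination hcs
  rw [hJ, hcos]
  field_simp
  ring_nf
  simp only [I_sq, I_pow_three]
  ring

/-! ### The phase function on the strip `|Im w| < π`. -/

/-- The phase function `w + λ sinh w`. -/
noncomputable def phase (lam : ℝ) (w : ℂ) : ℂ := w + lam * Complex.sinh w

theorem phase_re (lam : ℝ) (w : ℂ) :
    (phase lam w).re = w.re + lam * (Real.sinh w.re * Real.cos w.im) := by
  conv_lhs => rw [phase, ← re_add_im w, Complex.sinh_add, Complex.cosh_mul_I, Complex.sinh_mul_I]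
  simp [← ofReal_sinh, ← ofReal_cosh, ← ofReal_cos, ← ofReal_sin]

theorem phase_im (lam : ℝ) (w : ℂ) :
    (phase lam w).im = w.im + lam * (Real.cosh w.re * Real.sin w.im) := by
  conv_lhs => rw [phase, ← re_add_im w, Complex.sinh_add, Complex.cosh_mul_I, Complex.sinh_mul_I]
  simp [← ofReal_sinh, ← ofReal_cosh, ← ofReal_cos, ← ofReal_sin]

theorem phase_ofReal (lam p : ℝ) : phase lam p = ((p + lam * Real.sinh p : ℝ) : ℂ) := by
  simp [phase]

theorem hasDerivAt_phase (lam : ℝ) (w : ℂ) :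
    HasDerivAt (phase lam) (1 + lam * Complex.cosh w) w :=
  (hasDerivAt_id' w).add ((Complex.hasDerivAt_sinh w).const_mul _)

theorem hasDerivAt_real_phase (lam t : ℝ) :
    HasDerivAt (fun t : ℝ => t + lam * Real.sinh t) (1 + lam * Real.cosh t) t :=
  (hasDerivAt_id' t).add ((Real.hasDerivAt_sinh t).const_mul _)

theorem strictMono_real_phase {lam : ℝ} (hlam : 0 < lam) :
    StrictMono fun t : ℝ => t + lam * Real.sinh t :=
  strictMono_id.add (Real.sinh_strictMono.const_mul hlam)

/-- The open strip `|Im w| < π`. -/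
def phaseStrip : Set ℂ := {w | |w.im| < Real.pi}

theorem isOpen_phaseStrip : IsOpen phaseStrip :=
  isOpen_lt (by fun_prop) continuous_const

theorem ofReal_mem_phaseStrip (t : ℝ) : (t : ℂ) ∈ phaseStrip := by
  simp [phaseStrip, Real.pi_pos]

/-- In the strip `Im φ(w) = y + λ cosh x sin y` has the sign of `y = Im w`, so a real value forces
`w` real, where `φ` is strictly increasing. -/
theorem eq_of_phase_eq {lam : ℝ} (hlam : 0 < lam) {w : ℂ} (hw : w ∈ phaseStrip) {p : ℝ}
    (h : phase lam w = phase lam p) : w = p := by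
  have hw' := abs_lt.mp (show |w.im| < Real.pi from hw)
  have him := congrArg Complex.im h
  rw [phase_ofReal, ofReal_im, phase_im] at him
  have hc := Real.cosh_pos w.re
  have h0 : w.im = 0 := by
    rcases lt_trichotomy w.im 0 with h1 | h1 | h1
    · have h2 := Real.sin_neg_of_neg_of_neg_pi_lt h1 hw'.1
      have := mul_pos hlam (mul_pos hc (neg_pos.mpr h2))
      linarith
    · exact h1
    · have h2 := Real.sin_pos_of_pos_of_lt_pi h1 hw'.2
      have := mul_pos hlam (mul_pos hc h2)
      linarith
  have hre := congrArg Complex.re h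
  rw [phase_ofReal, ofReal_re, phase_re, h0, Real.cos_zero, mul_one] at hre
  exact Complex.ext (by simpa using (strictMono_real_phase hlam).injective hre) (by simpa using h0)

/-- Hence `p` is the only zero of `φ - φ(p)` in the strip, and it is simple because `φ'(p) > 0`. -/
theorem dslope_phase_ne_zero {lam : ℝ} (hlam : 0 < lam) (p : ℝ) {w : ℂ} (hw : w ∈ phaseStrip) :
    dslope (phase lam) p w ≠ 0 := by
  by_cases h : w = p
  · rw [h, dslope_same, (hasDerivAt_phase lam p).deriv, ← ofReal_cosh]
    have := mul_pos hlam (Real.cosh_pos p)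
    exact_mod_cast (by linarith : (0 : ℝ) < 1 + lam * Real.cosh p).ne'
  · rw [dslope_of_ne _ h, slope_def_field]
    exact div_ne_zero (sub_ne_zero.mpr fun e => h (eq_of_phase_eq hlam hw e)) (sub_ne_zero.mpr h)

theorem differentiableOn_inv_dslope_phase {lam : ℝ} (hlam : 0 < lam) (p : ℝ) (m : ℕ) :
    DifferentiableOn ℂ (fun w => (dslope (phase lam) p w)⁻¹ ^ (m + 1)) phaseStrip := by
  have h1 : DifferentiableOn ℂ (dslope (phase lam) p) phaseStrip :=
    (differentiableOn_dslope (isOpen_phaseStrip.mem_nhds (ofReal_mem_phaseStrip p))).mpr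
      fun w _ => (hasDerivAt_phase lam w).differentiableAt.differentiableWithinAt
  exact (h1.inv fun w hw => dslope_phase_ne_zero hlam p hw).pow _

theorem inv_dslope_phase_mul {lam : ℝ} {p : ℝ} (m : ℕ) {w : ℂ} (hw : w ≠ p) :
    (dslope (phase lam) p w)⁻¹ ^ (m + 1) * ((w - p) ^ (m + 1))⁻¹ =
      ((phase lam w - phase lam p) ^ (m + 1))⁻¹ := by
  have h := sub_ne_zero.mpr hw
  rw [dslope_of_ne _ hw, slope_def_field, inv_div, div_pow]
  field_simp

/-! ### The phase on the lines `Im w = ±π/2`. -/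

/-- `π/2 + λ cosh u - iu = -i φ(u + iπ/2)` for the phase function `φ`. -/
noncomputable def shiftedPhase (lam u : ℝ) : ℂ := Real.pi / 2 + lam * (Real.cosh u : ℂ) - u * I

theorem continuous_shiftedPhase (lam : ℝ) : Continuous (shiftedPhase lam) := by
  unfold shiftedPhase
  fun_prop

theorem shiftedPhase_re (lam u : ℝ) :
    (shiftedPhase lam u).re = Real.pi / 2 + lam * Real.cosh u := by
  have : shiftedPhase lam u = ((Real.pi / 2 + lam * Real.cosh u : ℝ) : ℂ) - u * I := by
    simp [shiftedPhase]
  rw [this]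
  simp [-ofReal_add, -ofReal_cosh]

theorem one_le_shiftedPhase_re {lam : ℝ} (hlam : 0 < lam) (u : ℝ) :
    1 ≤ (shiftedPhase lam u).re := by
  have := mul_pos hlam (Real.cosh_pos u)
  have := Real.pi_gt_three
  rw [shiftedPhase_re]
  linarith

theorem phase_add_half_pi (lam u : ℝ) :
    phase lam (u + ((Real.pi / 2 : ℝ) : ℂ) * I) = I * shiftedPhase lam u := by
  rw [phase, Complex.sinh_add, Complex.cosh_mul_I, Complex.sinh_mul_I, ← ofReal_cos, ← ofReal_sin,
    Real.cos_pi_div_two, Real.sin_pi_div_two, shiftedPhase]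
  push_cast
  linear_combination (u : ℂ) * I_sq

theorem phase_sub_half_pi (lam u : ℝ) :
    phase lam (u + ((-(Real.pi / 2) : ℝ) : ℂ) * I) = -(I * shiftedPhase lam (-u)) := by
  rw [phase, Complex.sinh_add, Complex.cosh_mul_I, Complex.sinh_mul_I, ← ofReal_cos, ← ofReal_sin,
    Real.cos_neg, Real.sin_neg, Real.cos_pi_div_two, Real.sin_pi_div_two, shiftedPhase, Real.cosh_neg]
  push_cast
  linear_combination (u : ℂ) * I_sq

theorem integrable_inv_shiftedPhase_re_pow {lam : ℝ} (hlam : 0 < lam) (m : ℕ) :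
    Integrable fun u : ℝ => ((shiftedPhase lam u).re ^ (m + 1))⁻¹ := by
  have hc : Continuous fun u : ℝ => (shiftedPhase lam u).re :=
    Complex.continuous_re.comp (continuous_shiftedPhase lam)
  have h1 := one_le_shiftedPhase_re hlam
  -- Chosen so that `c (1 + u²) ≤ π/2 + λ cosh u`, using `cosh u ≥ u²/4`.
  set c := min 1 (lam / 4) with hcd
  have hc0 : 0 < c := lt_min one_pos (by linarith)
  refine (integrable_inv_one_add_sq.const_mul c⁻¹).mono'
    (hc.pow _ |>.inv₀ fun u => (pow_pos (one_pos.trans_le (h1 u)) _).ne').aestronglyMeasurable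
    (.of_forall fun u => ?_)
  have hp := one_pos.trans_le (h1 u)
  rw [Real.norm_of_nonneg (by positivity), ← mul_inv]
  apply inv_anti₀ (by positivity)
  calc c * (1 + u ^ 2) ≤ (shiftedPhase lam u).re := by
        have h2 := sq_div_two_le_exp_add_exp_neg u
        have h3 : u ^ 2 / 4 ≤ Real.cosh u := by rw [Real.cosh_eq]; linarith
        have h4 := mul_le_mul_of_nonneg_left h3 hlam.le
        have h5 := mul_le_mul_of_nonneg_right (min_le_right 1 (lam / 4)) (sq_nonneg u)
        have h6 := min_le_left 1 (lam / 4)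
        have := Real.pi_gt_three
        rw [shiftedPhase_re]
        rw [← hcd] at h5 h6
        linarith
    _ ≤ _ := le_self_pow₀ (h1 u) m.succ_ne_zero

theorem shiftedPhase_re_le_norm (lam u s : ℝ) :
    (shiftedPhase lam u).re ≤ ‖I * shiftedPhase lam u - s‖ := by
  refine le_trans ?_ (Complex.abs_im_le_norm _)
  simpa using le_abs_self _

theorem integrable_inv_mul_shiftedPhase_sub {lam : ℝ} (hlam : 0 < lam) (s : ℝ) (m : ℕ) :
    Integrable fun u : ℝ => ((I * shiftedPhase lam u - s) ^ (m + 1))⁻¹ := by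
  have h1 := one_le_shiftedPhase_re hlam
  have hpos : ∀ u, 0 < ‖I * shiftedPhase lam u - s‖ := fun u =>
    (one_pos.trans_le (h1 u)).trans_le (shiftedPhase_re_le_norm lam u s)
  refine (integrable_inv_shiftedPhase_re_pow hlam m).mono' ?_ (.of_forall fun u => ?_)
  · refine Continuous.aestronglyMeasurable ?_
    refine Continuous.inv₀ ?_ fun u => pow_ne_zero _ (norm_pos_iff.mp (hpos u))
    exact ((continuous_const.mul (continuous_shiftedPhase lam)).sub continuous_const).pow _
  · rw [norm_inv, norm_pow]
    have := one_pos.trans_le (h1 u)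
    gcongr
    exact shiftedPhase_re_le_norm lam u s

theorem integrable_inv_neg_mul_shiftedPhase_sub {lam : ℝ} (hlam : 0 < lam) (s : ℝ) (m : ℕ) :
    Integrable fun u : ℝ => ((-(I * shiftedPhase lam u) - s) ^ (m + 1))⁻¹ := by
  refine ((integrable_inv_mul_shiftedPhase_sub hlam (-s) m).const_mul ((-1) ^ (m + 1))).congr
    (.of_forall fun u => ?_)
  have e : -(I * shiftedPhase lam u) - s = -1 * (I * shiftedPhase lam u - ((-s : ℝ) : ℂ)) := by
    push_cast; ring
  have h1 : ((-1 : ℂ) ^ (m + 1))⁻¹ = (-1) ^ (m + 1) := by rw [← inv_pow]; norm_num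
  simp only [e, mul_pow, mul_inv, h1]

theorem tendsto_integral_vertical {lam : ℝ} (hlam : 0 < lam) (s : ℝ) (m : ℕ) {ε : ℝ}
    (hε : ε = 1 ∨ ε = -1) :
    Tendsto (fun T : ℝ => ∫ y in -(Real.pi / 2)..(Real.pi / 2),
      ((phase lam (((ε * T : ℝ) : ℂ) + y * I) - s) ^ (m + 1))⁻¹) atTop (𝓝 0) := by
  have hε2 : ε * ε = 1 := by rcases hε with rfl | rfl <;> norm_num
  have hb : ∀ᶠ T : ℝ in atTop, ‖∫ y in -(Real.pi / 2)..(Real.pi / 2),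
      ((phase lam (((ε * T : ℝ) : ℂ) + y * I) - s) ^ (m + 1))⁻¹‖ ≤ (T - |s|)⁻¹ * Real.pi := by
    filter_upwards [eventually_ge_atTop (|s| + 1)] with T hT
    have hT0 : 0 ≤ T := by linarith [abs_nonneg s]
    have := intervalIntegral.norm_integral_le_of_norm_le_const (a := -(Real.pi / 2))
      (b := Real.pi / 2) (C := (T - |s|)⁻¹)
      (f := fun y : ℝ => ((phase lam (((ε * T : ℝ) : ℂ) + y * I) - s) ^ (m + 1))⁻¹) ?_
    · refine this.trans (le_of_eq ?_)
      rw [sub_neg_eq_add, add_halves, abs_of_pos Real.pi_pos]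
    · intro y hy
      rw [uIoc_of_le (by linarith [Real.pi_pos])] at hy
      -- On `|y| ≤ π/2` the term `λ sinh x cos y` has the sign of `x`, so `|Re φ| ≥ T` on the
      -- vertical edges.
      have hcos : 0 ≤ Real.cos y := Real.cos_nonneg_of_mem_Icc ⟨hy.1.le, hy.2⟩
      have hsinh : 0 ≤ ε * Real.sinh (ε * T) := by
        rcases hε with rfl | rfl
        · simpa using hT0
        · simpa using hT0
      have hre : T - |s| ≤ ‖phase lam (((ε * T : ℝ) : ℂ) + y * I) - s‖ := by
        have h1 : T - |s| ≤ ε * (phase lam (((ε * T : ℝ) : ℂ) + y * I) - s).re := by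
          rw [sub_re, phase_re, ofReal_re]
          simp only [add_re, ofReal_re, mul_re, I_re, mul_zero, ofReal_im, I_im, mul_one, sub_self,
            add_zero, add_im, mul_im, zero_add]
          have h2 := mul_nonneg hlam.le (mul_nonneg hsinh hcos)
          have h3 : ε * s ≤ |s| := by
            rcases hε with rfl | rfl
            · simpa using le_abs_self s
            · simpa using neg_le_abs s
          have h4 : ε * (ε * T) = T := by rw [← mul_assoc, hε2, one_mul]
          linarith
        refine h1.trans ((le_abs_self _).trans ?_)
        rw [abs_mul]
        have : |ε| = 1 := by rcases hε with rfl | rfl <;> norm_num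
        rw [this, one_mul]
        exact Complex.abs_re_le_norm _
      rw [norm_inv, norm_pow]
      apply inv_anti₀ (by linarith)
      exact hre.trans (le_self_pow₀ (by linarith) m.succ_ne_zero)
  refine squeeze_zero_norm' hb ?_
  have h := (tendsto_inv_atTop_zero.comp (tendsto_atTop_add_const_right atTop (-|s|) tendsto_id)).mul_const
    Real.pi
  simpa [Function.comp_def, sub_eq_add_neg] using h

/-! ### Residue evaluation and the coefficients. -/

/-- The residue theorem for `(φ - φ(p))^{-(m+1)}` on the strip `|Im w| ≤ π/2`. -/
theorem integral_inv_shiftedPhase {lam : ℝ} (hlam : 0 < lam) (p : ℝ) (m : ℕ) :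
    (∫ u : ℝ, ((-(I * shiftedPhase lam u) - (p + lam * Real.sinh p : ℝ)) ^ (m + 1))⁻¹) -
        ∫ u : ℝ, ((I * shiftedPhase lam u - (p + lam * Real.sinh p : ℝ)) ^ (m + 1))⁻¹ =
      2 * Real.pi * I *
        (iteratedDeriv m (fun w => (dslope (phase lam) p w)⁻¹ ^ (m + 1)) p / m.factorial) := by
  set s : ℝ := p + lam * Real.sinh p with hs
  have hh : 0 < Real.pi / 2 := by linarith [Real.pi_pos]
  have hS : {w : ℂ | |w.im| ≤ Real.pi / 2} ⊆ phaseStrip := fun w hw =>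
    lt_of_le_of_lt (show |w.im| ≤ Real.pi / 2 from hw) (by linarith [Real.pi_pos])
  have hF := differentiableOn_inv_dslope_phase hlam p m
  have hps : phase lam p = s := phase_ofReal lam p
  have hne : ∀ x y : ℝ, (y ≠ 0 ∨ x ≠ p) → (x + y * I : ℂ) ≠ p := by
    intro x y hxy e
    have e1 := congrArg re e
    have e2 := congrArg im e
    simp at e1 e2
    tauto
  have hrect : ∀ T : ℝ, |p| < T →
      (∫ u in -T..T, ((-(I * shiftedPhase lam (-u)) - s) ^ (m + 1))⁻¹) -
        (∫ u in -T..T, ((I * shiftedPhase lam u - s) ^ (m + 1))⁻¹) +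
        I * (∫ y in -(Real.pi / 2)..(Real.pi / 2),
          ((phase lam (((1 * T : ℝ) : ℂ) + y * I) - s) ^ (m + 1))⁻¹) -
        I * (∫ y in -(Real.pi / 2)..(Real.pi / 2),
          ((phase lam (((-1 * T : ℝ) : ℂ) + y * I) - s) ^ (m + 1))⁻¹) =
      2 * Real.pi * I *
        (iteratedDeriv m (fun w => (dslope (phase lam) p w)⁻¹ ^ (m + 1)) p / m.factorial) := by
    intro T hT
    have hT' := abs_lt.mp hT
    rw [← iterate_dslope_eq_iteratedDeriv (hF.analyticAt (isOpen_phaseStrip.mem_nhds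
      (ofReal_mem_phaseStrip p))), ← rectIntegral_div_pow hh hT isOpen_phaseStrip hS m hF,
      rectIntegral]
    congr 1
    · congr 1
      · congr 1
        · refine intervalIntegral.integral_congr fun u _ => ?_
          rw [inv_dslope_phase_mul _ (hne _ _ (.inl (by linarith))), phase_sub_half_pi, hps]
        · refine intervalIntegral.integral_congr fun u _ => ?_
          rw [inv_dslope_phase_mul _ (hne _ _ (.inl (by linarith))), phase_add_half_pi, hps]
      · congr 1
        refine intervalIntegral.integral_congr fun y _ => ?_
        rw [inv_dslope_phase_mul _ (hne _ _ (.inr (by linarith))), hps, one_mul]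
    · congr 1
      refine intervalIntegral.integral_congr fun y _ => ?_
      rw [inv_dslope_phase_mul _ (hne _ _ (.inr (by linarith))), hps, neg_one_mul]
  have hneg := integrable_inv_neg_mul_shiftedPhase_sub hlam s m
  -- On the lower line the phase carries `-u`; the reflection is removed once the integral extends
  -- over all of `ℝ`.
  have l1 := intervalIntegral_tendsto_integral hneg.comp_neg tendsto_neg_atTop_atBot tendsto_id
  have l2 := intervalIntegral_tendsto_integral (integrable_inv_mul_shiftedPhase_sub hlam s m)
    tendsto_neg_atTop_atBot tendsto_id
  have l3 := (tendsto_integral_vertical hlam s m (.inl rfl)).const_mul I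
  have l4 := (tendsto_integral_vertical hlam s m (.inr rfl)).const_mul I
  have hl := ((l1.sub l2).add l3).sub l4
  rw [mul_zero, add_zero, sub_zero,
    integral_neg_eq_self (fun u : ℝ => ((-(I * shiftedPhase lam u) - s) ^ (m + 1))⁻¹)] at hl
  refine tendsto_nhds_unique hl (tendsto_const_nhds.congr' ?_)
  filter_upwards [eventually_gt_atTop |p|] with T hT
  exact (hrect T hT).symm

/-- This turns the complex derivative in the residue into the real one in `awCoeff`. -/
theorem iteratedDeriv_ofReal {F : ℂ → ℂ} {r : ℝ → ℝ} {S : Set ℂ} (hS : IsOpen S)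
    (hSr : ∀ t : ℝ, (t : ℂ) ∈ S) (hF : DifferentiableOn ℂ F S) (h : ∀ t : ℝ, F t = r t)
    (m : ℕ) (t : ℝ) : iteratedDeriv m F t = (iteratedDeriv m r t : ℝ) := by
  induction m generalizing F r with
  | zero => simpa using h t
  | succ m ih =>
    rw [iteratedDeriv_succ', iteratedDeriv_succ']
    refine ih (hF.deriv hS) fun t => ?_
    have h1 := (hF.differentiableAt (hS.mem_nhds (hSr t))).hasDerivAt
    have h2 : HasDerivAt r (deriv F t).re t := by
      have := h1.real_of_complex
      simpa only [h, ofReal_re] using this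
    have h3 : HasDerivAt (fun t : ℝ => (r t : ℂ)) (deriv F t) t := by
      simpa only [h] using h1.comp_ofReal
    rw [h2.deriv]
    exact h3.unique h2.ofReal_comp

theorem inv_dslope_phase_zero_ofReal {lam : ℝ} (t : ℝ) :
    (dslope (phase lam) ((0 : ℝ) : ℂ) t)⁻¹ = (sinhQuotient lam t : ℂ) := by
  by_cases h : t = 0
  · subst h
    rw [dslope_same, (hasDerivAt_phase lam _).deriv]
    simp [sinhQuotient, add_comm]
  · have h' : (t : ℂ) ≠ ((0 : ℝ) : ℂ) := by exact_mod_cast h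
    rw [dslope_of_ne _ h', slope_def_field, phase_ofReal, phase_ofReal, sinhQuotient, if_neg h]
    simp [add_comm]

theorem contDiffAt_sinhQuotient_pow {lam : ℝ} (hlam : 0 < lam) (n k : ℕ) :
    ContDiffAt ℝ k (fun t : ℝ => sinhQuotient lam t ^ (n + 1)) 0 := by
  have hF := (differentiableOn_inv_dslope_phase hlam 0 n).analyticAt
    (isOpen_phaseStrip.mem_nhds (ofReal_mem_phaseStrip 0))
  have := (hF.contDiffAt (n := k)).real_of_complex
  refine this.congr_of_eventuallyEq (.of_forall fun t => ?_)
  simp only [inv_dslope_phase_zero_ofReal, ← ofReal_pow, ofReal_re]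

/-- The residue formula at `p = 0`: the exponent is odd, so the two lines contribute equally instead
of cancelling. -/
theorem integral_inv_shiftedPhase_pow {lam : ℝ} (hlam : 0 < lam) (n : ℕ) :
    ∫ u : ℝ, (shiftedPhase lam u ^ (2 * n + 1))⁻¹ = (-1) ^ n * Real.pi * (awCoeff n lam : ℂ) := by
  have h := integral_inv_shiftedPhase hlam 0 (2 * n)
  have hI : (I ^ (2 * n + 1))⁻¹ = (-1) ^ n * (-I) := by
    rw [pow_succ, pow_mul, I_sq, mul_inv, inv_I, ← inv_pow]; norm_num
  have hodd : (-1 : ℂ) ^ (2 * n + 1) = -1 := by rw [pow_succ, pow_mul]; norm_num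
  have e1 : ∀ u : ℝ, ((-(I * shiftedPhase lam u) - ((0 : ℝ) : ℂ)) ^ (2 * n + 1))⁻¹ =
      (-1) ^ n * I * (shiftedPhase lam u ^ (2 * n + 1))⁻¹ := by
    intro u
    rw [ofReal_zero, sub_zero, ← neg_one_mul, mul_pow, mul_pow, mul_inv, mul_inv, hI, hodd]
    norm_num
  have e2 : ∀ u : ℝ, ((I * shiftedPhase lam u - ((0 : ℝ) : ℂ)) ^ (2 * n + 1))⁻¹ =
      (-1) ^ n * (-I) * (shiftedPhase lam u ^ (2 * n + 1))⁻¹ := by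
    intro u
    rw [ofReal_zero, sub_zero, mul_pow, mul_inv, hI]
  have e3 : (iteratedDeriv (2 * n)
      (fun w => (dslope (phase lam) ((0 : ℝ) : ℂ) w)⁻¹ ^ (2 * n + 1)) ((0 : ℝ) : ℂ) /
        (2 * n).factorial) = (awCoeff n lam : ℂ) := by
    rw [iteratedDeriv_ofReal isOpen_phaseStrip ofReal_mem_phaseStrip
      (differentiableOn_inv_dslope_phase hlam 0 (2 * n))
      (r := fun t => sinhQuotient lam t ^ (2 * n + 1))
      (fun t => by simp only [inv_dslope_phase_zero_ofReal, ofReal_pow]), awCoeff]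
    push_cast
    ring
  rw [Real.sinh_zero, mul_zero, add_zero, e3] at h
  simp only [e1, e2, integral_const_mul] at h
  have h1 : ((-1 : ℂ) ^ n) * (-1) ^ n = 1 := by rw [← mul_pow]; norm_num
  have hI0 := I_ne_zero
  have h2 : (2 * I) * (∫ u : ℝ, (shiftedPhase lam u ^ (2 * n + 1))⁻¹) =
      (2 * I) * ((-1) ^ n * Real.pi * (awCoeff n lam : ℂ)) := by
    linear_combination (-1 : ℂ) ^ n * h - (2 * I * ∫ u : ℝ, (shiftedPhase lam u ^ (2 * n + 1))⁻¹) * h1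
  exact mul_left_cancel₀ (mul_ne_zero two_ne_zero hI0) h2

/-- The simple pole at `t`, with residue `1/φ'(t)`. -/
theorem integral_inv_shiftedPhase_add {lam : ℝ} (hlam : 0 < lam) (t : ℝ) :
    ∫ u : ℝ, ((shiftedPhase lam u - (t + lam * Real.sinh t : ℝ) * I)⁻¹ +
      (shiftedPhase lam u + (t + lam * Real.sinh t : ℝ) * I)⁻¹) =
      2 * Real.pi / (1 + lam * Real.cosh t : ℝ) := by
  have h := integral_inv_shiftedPhase hlam t 0
  set s : ℝ := t + lam * Real.sinh t
  have i1 := integrable_inv_neg_mul_shiftedPhase_sub hlam s 0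
  have i2 := integrable_inv_mul_shiftedPhase_sub hlam s 0
  rw [← integral_sub i1 i2] at h
  have e : ∀ u : ℝ, ((-(I * shiftedPhase lam u) - s) ^ (0 + 1))⁻¹ -
      ((I * shiftedPhase lam u - s) ^ (0 + 1))⁻¹ =
      I * ((shiftedPhase lam u - s * I)⁻¹ + (shiftedPhase lam u + s * I)⁻¹) := by
    intro u
    have e1 : -(I * shiftedPhase lam u) - s = -I * (shiftedPhase lam u - s * I) := by
      linear_combination -(s : ℂ) * I_sq
    have e2 : I * shiftedPhase lam u - s = I * (shiftedPhase lam u + s * I) := by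
      linear_combination -(s : ℂ) * I_sq
    rw [zero_add, pow_one, pow_one, e1, e2, mul_inv, mul_inv, inv_neg, inv_I]
    ring
  simp only [e, integral_const_mul] at h
  simp only [iteratedDeriv_zero, dslope_same, (hasDerivAt_phase lam _).deriv, zero_add, pow_one,
    Nat.factorial_zero, Nat.cast_one, div_one] at h
  refine mul_left_cancel₀ I_ne_zero (h.trans ?_)
  push_cast
  ring

/-! ### Laplace integrals and integrability on the product. -/

theorem integrableOn_pow_mul_cexp_neg_mul (k : ℕ) {r : ℂ} (hr : 0 < r.re) :
    IntegrableOn (fun x : ℝ => (x : ℂ) ^ k * cexp (-(x : ℂ) * r)) (Ioi 0) := by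
  have h := integrableOn_rpow_mul_exp_neg_mul_rpow (p := 1) (s := k) (b := r.re)
    (by linarith [k.cast_nonneg (α := ℝ)]) one_pos hr
  refine Integrable.mono' h (by fun_prop) ?_
  filter_upwards [ae_restrict_mem measurableSet_Ioi] with x hx
  have hx0 : 0 < x := hx
  rw [norm_mul, norm_pow, norm_real, Real.norm_of_nonneg hx0.le, Complex.norm_exp, Real.rpow_natCast,
    Real.rpow_one, ← ofReal_neg, re_ofReal_mul, neg_mul, neg_mul, mul_comm x]

theorem integral_pow_mul_cexp_neg_mul (k : ℕ) {r : ℂ} (hr : 0 < r.re) :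
    ∫ x in Ioi (0 : ℝ), (x : ℂ) ^ k * cexp (-(x : ℂ) * r) = k.factorial * (r ^ (k + 1))⁻¹ := by
  have h0 : r ≠ 0 := by rintro rfl; simp at hr
  have hexp : ∀ x : ℝ, HasDerivAt (fun x : ℝ => cexp (-(x : ℂ) * r)) (-r * cexp (-(x : ℂ) * r)) x := by
    intro x
    refine (((hasDerivAt_id x).ofReal_comp.neg.mul_const r).cexp).congr_deriv ?_
    simp [mul_comm]
  induction k with
  | zero =>
    have i0 := integrableOn_pow_mul_cexp_neg_mul 0 hr
    simp only [pow_zero, one_mul] at i0 ⊢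
    have i1 : IntegrableOn (fun x : ℝ => -r * cexp (-(x : ℂ) * r)) (Ioi 0) := i0.const_mul _
    have h := integral_Ioi_of_hasDerivAt_of_tendsto' (fun x _ => hexp x) i1
      (tendsto_zero_of_hasDerivAt_of_integrableOn_Ioi (fun x _ => hexp x) i1 i0)
    rw [integral_const_mul] at h
    simp only [ofReal_zero, neg_zero, zero_mul, Complex.exp_zero, zero_sub] at h
    rw [zero_add, pow_one, Nat.factorial_zero, Nat.cast_one, one_mul]
    refine eq_inv_of_mul_eq_one_right ?_
    linear_combination -h
  | succ k ih =>
    have i0 := integrableOn_pow_mul_cexp_neg_mul k hr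
    have i1 := integrableOn_pow_mul_cexp_neg_mul (k + 1) hr
    have hd : ∀ x : ℝ, HasDerivAt (fun x : ℝ => (x : ℂ) ^ (k + 1) * cexp (-(x : ℂ) * r))
        ((k + 1) * ((x : ℂ) ^ k * cexp (-(x : ℂ) * r)) -
          r * ((x : ℂ) ^ (k + 1) * cexp (-(x : ℂ) * r))) x := by
      intro x
      refine (((hasDerivAt_pow (k + 1) (x : ℂ)).comp_ofReal).mul (hexp x)).congr_deriv ?_
      push_cast
      ring
    have i2 : IntegrableOn (fun x : ℝ => (k + 1) * ((x : ℂ) ^ k * cexp (-(x : ℂ) * r)) -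
        r * ((x : ℂ) ^ (k + 1) * cexp (-(x : ℂ) * r))) (Ioi 0) :=
      (i0.const_mul _).sub (i1.const_mul _)
    have h := integral_Ioi_of_hasDerivAt_of_tendsto' (fun x _ => hd x) i2
      (tendsto_zero_of_hasDerivAt_of_integrableOn_Ioi (fun x _ => hd x) i2 i1)
    rw [integral_sub (i0.const_mul _) (i1.const_mul _), integral_const_mul, integral_const_mul, ih,
      ofReal_zero, zero_pow k.succ_ne_zero, zero_mul, sub_zero] at h
    refine mul_left_cancel₀ h0 ?_
    rw [← sub_eq_zero.mp h, Nat.factorial_succ]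
    push_cast
    field_simp
    ring

/-- The inner integral of the norm, needed to apply Fubini in `(x, u)`. -/
theorem integral_norm_pow_mul_cexp_neg_mul (k : ℕ) {r : ℂ} (hr : 0 < r.re) :
    ∫ x in Ioi (0 : ℝ), ‖(x : ℂ) ^ k * cexp (-(x : ℂ) * r)‖ = k.factorial * (r.re ^ (k + 1))⁻¹ := by
  have h := integral_pow_mul_cexp_neg_mul k (r := (r.re : ℂ)) (by simpa using hr)
  apply ofReal_injective
  rw [← integral_complex_ofReal]
  push_cast
  rw [← h]
  refine setIntegral_congr_fun measurableSet_Ioi fun x hx => ?_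
  have hx0 : 0 < x := hx
  rw [norm_mul, norm_pow, norm_real, Real.norm_of_nonneg hx0.le, Complex.norm_exp, ← ofReal_neg,
    re_ofReal_mul]
  push_cast
  rfl

theorem integrable_prod_pow_mul_cexp {lam : ℝ} (hlam : 0 < lam) (k : ℕ) :
    Integrable (fun z : ℝ × ℝ => (z.1 : ℂ) ^ k * cexp (-(z.1 : ℂ) * shiftedPhase lam z.2))
      ((volume.restrict (Ioi 0)).prod volume) := by
  have hpos : ∀ u, 0 < (shiftedPhase lam u).re := fun u =>
    one_pos.trans_le (one_le_shiftedPhase_re hlam u)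
  have hc := continuous_shiftedPhase lam
  have hm : AEStronglyMeasurable
      (fun z : ℝ × ℝ => (z.1 : ℂ) ^ k * cexp (-(z.1 : ℂ) * shiftedPhase lam z.2))
      ((volume.restrict (Ioi 0)).prod volume) := by
    refine Continuous.aestronglyMeasurable ?_
    have := hc.comp (continuous_snd (X := ℝ) (Y := ℝ))
    fun_prop
  rw [integrable_prod_iff' hm]
  refine ⟨Filter.Eventually.of_forall fun u => ?_, ?_⟩
  · exact (integrableOn_pow_mul_cexp_neg_mul k (hpos u)).integrable
  simp only [integral_norm_pow_mul_cexp_neg_mul k (hpos _)]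
  exact (integrable_inv_shiftedPhase_re_pow hlam k).const_mul _

/-! ### Moments and cosine transform of the Hankel weight. -/

/-- `e^{-πx} i H_{ix}^{(1)}(iλx)`. -/
noncomputable def hankelWeight (lam x : ℝ) : ℂ :=
  cexp (-(Real.pi : ℂ) * x) * (I * hankelH1 (I * x) (lam * I * x))

theorem hankelWeight_eq {lam x : ℝ} (hlam : 0 < lam) (hx : 0 < x) :
    hankelWeight lam x = 1 / (Real.pi : ℂ) * ∫ u : ℝ, cexp (-(x : ℂ) * shiftedPhase lam u) :=
  hankelH1_imaginary hlam hx

theorem coeffIntegrand_eq (n : ℕ) (lam x : ℝ) :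
    coeffIntegrand n lam x = (x : ℂ) ^ (2 * n) * hankelWeight lam x := by
  rw [coeffIntegrand, hankelWeight, mul_assoc]

theorem pow_mul_hankelWeight_eq {lam x : ℝ} (hlam : 0 < lam) (hx : 0 < x) (k : ℕ) :
    (x : ℂ) ^ k * hankelWeight lam x = 1 / (Real.pi : ℂ) *
      ∫ u : ℝ, (x : ℂ) ^ k * cexp (-(x : ℂ) * shiftedPhase lam u) := by
  rw [hankelWeight_eq hlam hx, integral_const_mul]
  ring

theorem integrableOn_pow_mul_hankelWeight {lam : ℝ} (hlam : 0 < lam) (k : ℕ) :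
    IntegrableOn (fun x : ℝ => (x : ℂ) ^ k * hankelWeight lam x) (Ioi 0) := by
  refine ((integrable_prod_pow_mul_cexp hlam k).integral_prod_left.const_mul
    (1 / (Real.pi : ℂ))).congr ?_
  filter_upwards [ae_restrict_mem measurableSet_Ioi] with x hx
  exact (pow_mul_hankelWeight_eq hlam hx k).symm

theorem integral_pow_mul_hankelWeight {lam : ℝ} (hlam : 0 < lam) (k : ℕ) :
    ∫ x in Ioi (0 : ℝ), (x : ℂ) ^ k * hankelWeight lam x =
      k.factorial / (Real.pi : ℂ) * ∫ u : ℝ, (shiftedPhase lam u ^ (k + 1))⁻¹ := by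
  rw [setIntegral_congr_fun measurableSet_Ioi fun x hx => pow_mul_hankelWeight_eq hlam hx k,
    integral_const_mul, integral_integral_swap (integrable_prod_pow_mul_cexp hlam k)]
  simp only [integral_pow_mul_cexp_neg_mul k (one_pos.trans_le (one_le_shiftedPhase_re hlam _)),
    integral_const_mul]
  ring

theorem awCoeff_eq_integral {lam : ℝ} (hlam : 0 < lam) (n : ℕ) :
    (awCoeff n lam : ℂ) =
      (-1 : ℂ) ^ n / ((2 * n).factorial : ℂ) * ∫ t in Ioi (0 : ℝ), coeffIntegrand n lam t := by
  have hpi : (Real.pi : ℂ) ≠ 0 := by exact_mod_cast Real.pi_ne_zero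
  have hf : ((2 * n).factorial : ℂ) ≠ 0 := by exact_mod_cast (2 * n).factorial_ne_zero
  have h1 : ((-1 : ℂ) ^ n) * (-1) ^ n = 1 := by rw [← mul_pow]; norm_num
  simp only [coeffIntegrand_eq]
  rw [integral_pow_mul_hankelWeight hlam, integral_inv_shiftedPhase_pow hlam]
  field_simp
  linear_combination (-(awCoeff n lam : ℂ)) * h1

theorem cos_mul_cexp_neg_mul (x s r : ℂ) :
    Complex.cos (x * s) * cexp (-x * r) =
      2⁻¹ * (x ^ 0 * cexp (-x * (r - s * I)) + x ^ 0 * cexp (-x * (r + s * I))) := by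
  have e1 : -x * (r - s * I) = x * s * I + -x * r := by ring
  have e2 : -x * (r + s * I) = -(x * s) * I + -x * r := by ring
  rw [Complex.cos, e1, e2, Complex.exp_add, Complex.exp_add]
  ring

theorem integral_cos_mul_cexp_neg_mul (s : ℝ) {r : ℂ} (hr : 0 < r.re) :
    ∫ x in Ioi (0 : ℝ), Complex.cos (x * s) * cexp (-(x : ℂ) * r) =
      2⁻¹ * ((r - s * I)⁻¹ + (r + s * I)⁻¹) := by
  have h1 : 0 < (r - s * I).re := by simpa using hr
  have h2 : 0 < (r + s * I).re := by simpa using hr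
  simp only [cos_mul_cexp_neg_mul]
  rw [integral_const_mul, integral_add (integrableOn_pow_mul_cexp_neg_mul 0 h1)
    (integrableOn_pow_mul_cexp_neg_mul 0 h2), integral_pow_mul_cexp_neg_mul 0 h1,
    integral_pow_mul_cexp_neg_mul 0 h2]
  simp

theorem norm_cos_ofReal_mul_le (x s : ℝ) : ‖Complex.cos ((x : ℂ) * s)‖ ≤ 1 := by
  rw [← ofReal_mul, ← ofReal_cos, norm_real]
  exact Real.abs_cos_le_one _

/-- Fubini: the `x`-integral yields two simple fractions in the phase, whose `u`-integral is the
residue at `t`. -/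
theorem integral_cos_mul_hankelWeight {lam : ℝ} (hlam : 0 < lam) (t : ℝ) :
    ∫ x in Ioi (0 : ℝ), Complex.cos (x * (t + lam * Real.sinh t : ℝ)) * hankelWeight lam x =
      ((1 + lam * Real.cosh t : ℝ) : ℂ)⁻¹ := by
  set s : ℝ := t + lam * Real.sinh t with hs
  have hpi : (Real.pi : ℂ) ≠ 0 := by exact_mod_cast Real.pi_ne_zero
  have hint : Integrable (fun z : ℝ × ℝ =>
      Complex.cos (z.1 * s) * cexp (-(z.1 : ℂ) * shiftedPhase lam z.2))
      ((volume.restrict (Ioi 0)).prod volume) := by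
    have h0 := integrable_prod_pow_mul_cexp hlam 0
    simp only [pow_zero, one_mul] at h0
    exact h0.bdd_mul (c := 1) (by fun_prop) (.of_forall fun z => norm_cos_ofReal_mul_le _ _)
  have e : ∀ x ∈ Ioi (0 : ℝ), Complex.cos (x * s) * hankelWeight lam x = 1 / (Real.pi : ℂ) *
      ∫ u : ℝ, Complex.cos (x * s) * cexp (-(x : ℂ) * shiftedPhase lam u) := by
    intro x hx
    rw [hankelWeight_eq hlam hx, integral_const_mul]
    ring
  rw [setIntegral_congr_fun measurableSet_Ioi e, integral_const_mul, integral_integral_swap hint]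
  simp only [integral_cos_mul_cexp_neg_mul s (one_pos.trans_le (one_le_shiftedPhase_re hlam _)),
    integral_const_mul]
  rw [hs, integral_inv_shiftedPhase_add hlam t]
  field_simp

/-! ### Change of variables, remainder and expansion. -/

theorem image_real_phase_Ioi {lam : ℝ} (hlam : 0 < lam) :
    (fun t : ℝ => t + lam * Real.sinh t) '' Ioi 0 = Ioi 0 := by
  have hm := strictMono_real_phase hlam
  have h0 : (fun t : ℝ => t + lam * Real.sinh t) 0 = 0 := by simp
  ext s
  constructor
  · rintro ⟨t, ht, rfl⟩
    have := hm ht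
    rwa [h0] at this
  · intro hs
    have hs0 : 0 < s := hs
    have hle : s ≤ s + lam * Real.sinh s := by
      have := mul_pos hlam (Real.sinh_pos_iff.mpr hs0)
      linarith
    obtain ⟨t, ht, hts⟩ := intermediate_value_Icc hs0.le
      (f := fun t : ℝ => t + lam * Real.sinh t)
      (continuous_id.add (Real.continuous_sinh.const_mul lam)).continuousOn
      ⟨h0.le.trans hs0.le, hle⟩
    refine ⟨t, lt_of_le_of_ne ht.1 ?_, hts⟩
    rintro rfl
    rw [h0] at hts
    exact hs0.ne hts

theorem integrableOn_cexp_neg_mul_phase {lam : ℝ} (hlam : 0 < lam) {ν : ℂ} (hν : 0 < ν.re) :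
    IntegrableOn (fun t : ℝ => cexp (-ν * (t : ℂ) - lam * ν * ((Real.sinh t : ℝ) : ℂ))) (Ioi 0) := by
  refine Integrable.mono' (integrableOn_pow_mul_cexp_neg_mul 0 hν).norm (by fun_prop) ?_
  filter_upwards [ae_restrict_mem measurableSet_Ioi] with t ht
  rw [pow_zero, one_mul, Complex.norm_exp, Complex.norm_exp]
  apply Real.exp_le_exp.mpr
  have h1 : 0 ≤ lam * Real.sinh t * ν.re :=
    (mul_pos (mul_pos hlam (Real.sinh_pos_iff.mpr ht)) hν).le
  have e : -ν * (t : ℂ) - lam * ν * ((Real.sinh t : ℝ) : ℂ) =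
      -(t : ℂ) * ν - ((lam * Real.sinh t : ℝ) : ℂ) * ν := by push_cast; ring
  rw [e, sub_re, re_ofReal_mul]
  linarith

theorem one_add_div_sq_eq {ν : ℂ} (hν : 0 < ν.re) (x : ℝ) :
    1 + ((x : ℂ) / ν) ^ 2 = (ν - x * I) * (ν + x * I) / ν ^ 2 := by
  have h0 : ν ≠ 0 := by rintro rfl; simp at hν
  field_simp
  linear_combination (x : ℂ) ^ 2 * I_sq

theorem one_add_div_sq_ne_zero {ν : ℂ} (hν : 0 < ν.re) (x : ℝ) : 1 + ((x : ℂ) / ν) ^ 2 ≠ 0 := by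
  have h0 : ν ≠ 0 := by rintro rfl; simp at hν
  have h1 : ν - x * I ≠ 0 := fun h => by have := congrArg re h; simp at this; linarith
  have h2 : ν + x * I ≠ 0 := fun h => by have := congrArg re h; simp at this; linarith
  rw [one_add_div_sq_eq hν]
  exact div_ne_zero (mul_ne_zero h1 h2) (pow_ne_zero _ h0)

theorem norm_inv_one_add_div_sq_le {ν : ℂ} (hν : 0 < ν.re) (x : ℝ) :
    ‖(1 + ((x : ℂ) / ν) ^ 2)⁻¹‖ ≤ ‖ν‖ ^ 2 / (ν.re * ν.re) := by
  have h1 : ν.re ≤ ‖ν - x * I‖ := by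
    simpa using (le_abs_self _).trans (Complex.abs_re_le_norm (ν - x * I))
  have h2 : ν.re ≤ ‖ν + x * I‖ := by
    simpa using (le_abs_self _).trans (Complex.abs_re_le_norm (ν + x * I))
  rw [one_add_div_sq_eq hν, inv_div, norm_div, norm_mul, norm_pow]
  gcongr

theorem inv_one_add_div_sq_eq_integral {ν : ℂ} (hν : 0 < ν.re) (x : ℝ) :
    (1 + ((x : ℂ) / ν) ^ 2)⁻¹ =
      ν * ∫ s in Ioi (0 : ℝ), Complex.cos (x * s) * cexp (-(s : ℂ) * ν) := by
  have h0 : ν ≠ 0 := by rintro rfl; simp at hν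
  have h1 : ν - x * I ≠ 0 := fun h => by have := congrArg re h; simp at this; linarith
  have h2 : ν + x * I ≠ 0 := fun h => by have := congrArg re h; simp at this; linarith
  simp only [mul_comm (x : ℂ)]
  rw [integral_cos_mul_cexp_neg_mul x hν, one_add_div_sq_eq hν]
  field_simp
  ring

theorem remainderIntegrand_eq (N : ℕ) (ν : ℂ) (lam x : ℝ) :
    remainderIntegrand N ν lam x =
      (1 + ((x : ℂ) / ν) ^ 2)⁻¹ * ((x : ℂ) ^ (2 * N) * hankelWeight lam x) := by
  rw [remainderIntegrand, hankelWeight]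
  ring

theorem integrableOn_remainderIntegrand {lam : ℝ} (hlam : 0 < lam) {ν : ℂ} (hν : 0 < ν.re) (N : ℕ) :
    IntegrableOn (remainderIntegrand N ν lam) (Ioi 0) := by
  have h := (integrableOn_pow_mul_hankelWeight hlam (2 * N)).integrable.bdd_mul
    (f := fun x : ℝ => (1 + ((x : ℂ) / ν) ^ 2)⁻¹) (Measurable.aestronglyMeasurable (by fun_prop))
    (.of_forall (norm_inv_one_add_div_sq_le hν))
  exact h.congr (.of_forall fun x => (remainderIntegrand_eq N ν lam x).symm)

theorem integral_remainderIntegrand_zero {lam : ℝ} (hlam : 0 < lam) {ν : ℂ} (hν : 0 < ν.re) :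
    ∫ x in Ioi (0 : ℝ), remainderIntegrand 0 ν lam x =
      ν * ∫ t in Ioi (0 : ℝ), cexp (-ν * (t : ℂ) - lam * ν * ((Real.sinh t : ℝ) : ℂ)) := by
  have hW : Integrable (hankelWeight lam) (volume.restrict (Ioi 0)) := by
    simpa only [pow_zero, one_mul] using (integrableOn_pow_mul_hankelWeight hlam 0).integrable
  have hE : Integrable (fun s : ℝ => cexp (-(s : ℂ) * ν)) (volume.restrict (Ioi 0)) := by
    simpa only [pow_zero, one_mul] using (integrableOn_pow_mul_cexp_neg_mul 0 hν).integrable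
  have hint : Integrable (fun z : ℝ × ℝ =>
      Complex.cos (z.1 * z.2) * (hankelWeight lam z.1 * cexp (-(z.2 : ℂ) * ν)))
      ((volume.restrict (Ioi 0)).prod (volume.restrict (Ioi 0))) :=
    (hW.mul_prod hE).bdd_mul (c := 1) (by fun_prop) (.of_forall fun z => norm_cos_ofReal_mul_le _ _)
  have e1 : ∀ x : ℝ, remainderIntegrand 0 ν lam x = ν * ∫ s in Ioi (0 : ℝ),
      Complex.cos (x * s) * (hankelWeight lam x * cexp (-(s : ℂ) * ν)) := by
    intro x
    rw [remainderIntegrand_eq, inv_one_add_div_sq_eq_integral hν, mul_assoc, ← integral_mul_const]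
    congr 2 with s
    ring
  have e2 : ∀ s : ℝ, ∫ x in Ioi (0 : ℝ),
      Complex.cos (x * s) * (hankelWeight lam x * cexp (-(s : ℂ) * ν)) =
      (∫ x in Ioi (0 : ℝ), Complex.cos (x * s) * hankelWeight lam x) * cexp (-(s : ℂ) * ν) := by
    intro s
    simp only [← mul_assoc, integral_mul_const]
  simp only [e1]
  rw [integral_const_mul, integral_integral_swap hint]
  simp only [e2]
  congr 1
  -- Under `s = φ(t)` the Jacobian `φ'(t)` cancels the cosine transform `1/φ'(t)`.
  have hcv := integral_image_eq_integral_abs_deriv_smul measurableSet_Ioi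
    (fun t (_ : t ∈ Ioi 0) => (hasDerivAt_real_phase lam t).hasDerivWithinAt)
    (strictMono_real_phase hlam).injective.injOn
    fun s : ℝ => (∫ x in Ioi (0 : ℝ), Complex.cos (x * s) * hankelWeight lam x) *
      cexp (-(s : ℂ) * ν)
  rw [image_real_phase_Ioi hlam] at hcv
  rw [hcv]
  refine setIntegral_congr_fun measurableSet_Ioi fun t _ => ?_
  have hpos : 0 < 1 + lam * Real.cosh t := by
    have := mul_pos hlam (Real.cosh_pos t)
    linarith
  have hne : ((1 + lam * Real.cosh t : ℝ) : ℂ) ≠ 0 := by exact_mod_cast hpos.ne'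
  rw [integral_cos_mul_hankelWeight hlam, abs_of_pos hpos, real_smul, ← mul_assoc,
    mul_inv_cancel₀ hne, one_mul]
  congr 1
  push_cast
  ring

/-- With `y = (x/ν)²`, use `1/(1+y) = 1 - y/(1+y)`: the first term is the moment that gives `a_N`,
the second the next remainder. -/
theorem remainder_succ {lam : ℝ} (hlam : 0 < lam) {ν : ℂ} (hν : 0 < ν.re) (N : ℕ) :
    remainder N ν lam = 1 / (Real.pi : ℂ) *
      (((2 * N).factorial : ℂ) * (awCoeff N lam : ℂ) / ν ^ (2 * N + 1)) + remainder (N + 1) ν lam := by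
  have h0 : ν ≠ 0 := by rintro rfl; simp at hν
  have hpi : (Real.pi : ℂ) ≠ 0 := by exact_mod_cast Real.pi_ne_zero
  have hf : ((2 * N).factorial : ℂ) ≠ 0 := by exact_mod_cast (2 * N).factorial_ne_zero
  have e : ∀ x : ℝ, remainderIntegrand N ν lam x =
      coeffIntegrand N lam x - (ν ^ 2)⁻¹ * remainderIntegrand (N + 1) ν lam x := by
    intro x
    have h1 := one_add_div_sq_ne_zero hν x
    rw [remainderIntegrand_eq, remainderIntegrand_eq, coeffIntegrand_eq,
      inv_mul_eq_iff_eq_mul₀ h1, mul_sub, mul_left_comm _ (ν ^ 2)⁻¹, mul_inv_cancel_left₀ h1]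
    field_simp
    ring
  have hc : Integrable (coeffIntegrand N lam) (volume.restrict (Ioi 0)) :=
    (integrableOn_pow_mul_hankelWeight hlam (2 * N)).congr
      (.of_forall fun x => (coeffIntegrand_eq N lam x).symm)
  have hI : ∫ x in Ioi (0 : ℝ), remainderIntegrand N ν lam x =
      (∫ x in Ioi (0 : ℝ), coeffIntegrand N lam x) -
        (ν ^ 2)⁻¹ * ∫ x in Ioi (0 : ℝ), remainderIntegrand (N + 1) ν lam x := by
    rw [← integral_const_mul, ← integral_sub hc
      ((integrableOn_remainderIntegrand hlam hν (N + 1)).integrable.const_mul _)]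
    simp only [← e]
  rw [remainder, remainder, hI, awCoeff_eq_integral hlam]
  field_simp
  ring

theorem theorem1 (lam : ℝ) (hlam : 0 < lam) :
    -- the two formulas for the coefficients, with the existence of the derivatives and the integrals
    (∀ n : ℕ,
      ContDiffAt ℝ (2 * n : ℕ) (fun t : ℝ => sinhQuotient lam t ^ (2 * n + 1)) 0 ∧
      IntegrableOn (coeffIntegrand n lam) (Ioi 0) ∧
      (awCoeff n lam : ℂ) =
        (-1 : ℂ) ^ n / ((2 * n).factorial : ℂ) * ∫ t in Ioi (0 : ℝ), coeffIntegrand n lam t) ∧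
    -- the expansion with its remainder, with the existence of the integrals
    (∀ (N : ℕ) (ν : ℂ), ν ≠ 0 → |Complex.arg ν| < Real.pi / 2 →
      IntegrableOn
        (fun t : ℝ => Complex.exp (-ν * (t : ℂ) - lam * ν * ((Real.sinh t : ℝ) : ℂ))) (Ioi 0) ∧
      IntegrableOn (remainderIntegrand N ν lam) (Ioi 0) ∧
      angerWeberA ν (lam * ν) =
        1 / (Real.pi : ℂ) *
            ∑ n ∈ Finset.range N,
              ((2 * n).factorial : ℂ) * (awCoeff n lam : ℂ) / ν ^ (2 * n + 1) +
          remainder N ν lam) := by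
  refine ⟨fun n => ⟨contDiffAt_sinhQuotient_pow hlam (2 * n) (2 * n), ?_,
    awCoeff_eq_integral hlam n⟩, fun N ν hν0 harg => ?_⟩
  · exact (integrableOn_pow_mul_hankelWeight hlam (2 * n)).congr
      (.of_forall fun x => (coeffIntegrand_eq n lam x).symm)
  have hν : 0 < ν.re := (Complex.abs_arg_lt_pi_div_two_iff.mp harg).resolve_right hν0
  refine ⟨integrableOn_cexp_neg_mul_phase hlam hν, integrableOn_remainderIntegrand hlam hν N, ?_⟩
  induction N with
  | zero =>
    rw [Finset.sum_range_zero, mul_zero, zero_add, remainder, integral_remainderIntegrand_zero hlam hν,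
      angerWeberA]
    field_simp
    simp [mul_comm]
  | succ N ih => rw [ih, remainder_succ hlam hν, Finset.sum_range_succ, mul_add, add_assoc]
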